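/- Let $0\le p\le n$ and let $\mathbb V=\mathbb R^n$ with coordinates $x$ and Euclidean inner product, and let $\mathbb W$ be a second copy of $\mathbb R^n$ with coordinates $\xi$; put $\mathbb E=\mathbb V\times\mathbb W$ and let $J$ exchange $dx_i$ and $d\xi_i$. Let $\mathcal D^{a,b}$ be the space of smooth forms $\alpha=\sum_{|K|=a,|L|=b}\alpha_{KL}(x)\,dx_K\wedge d\xi_L$ on $\mathbb E$ whose coefficients depend only on $x$ and have compact support in $\mathbb V$, with the usual test function topology, and let $d\alpha=\sum_{K,L}\sum_i\frac{\partial\alpha_{KL}}{\partial x_i}\,dx_i\wedge dx_K\wedge d\xi_L$. A $(p,p)$-current $T$ is a continuous linear functional on $\mathcal D^{n-p,n-p}$; write $T=\sum_{|I|=|J|=p}T_{IJ}\,dx_I\wedge d\xi_J$ with distributions $T_{IJ}$ on $\mathbb V$, where $\langle T_{IJ},\varphi\rangle=\pm\langle T,\varphi\,dx_{I^c}\wedge d\xi_{J^c}\rangle$, the sign being that of the permutation taking $dx_I\wedge d\xi_J\wedge dx_{I^c}\wedge d\xi_{J^c}$ to $dx_1\wedge d\xi_1\wedge\dots\wedge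 dx_n\wedge d\xi_n$. The current $T$ is closed if $dT=0$, i.e. $\langle T,d\alpha\rangle=0$ for all $\alpha\in\mathcal D^{n-p-1,n-p}$ (no condition if $p=n$). It is positive if it is symmetric ($T_{IJ}=T_{JI}$ for all $I,J$) and $$\big\langle T,\ (-1)^{(n-p)(n-p-1)/2}\,\beta\wedge J(\beta)\big\rangle\ \ge 0$$ for every smooth compactly supported $(n-p,0)$-form $\beta=\sum_{|K|=n-p}\beta_K(x)\,dx_K$. The support $\operatorname{Supp}T\subset\mathbb V$ is the complement of the largest open set $U$ such that $\langle T,\alpha\rangle=0$ for all $\alpha$ with support in $U$. We say that $T$ vanishes on a compact set $K\subset\mathbb V$ if every coefficient $T_{IJ}$ is a signed Radon measure with $|T_{IJ}|(K)=0$, where $|T_{IJ}|$ is its total variation. Let $\mathcal H^{s}$ denote $s$-dimensional Hausdorff measure on $\mathbb V$. Let $T$ be a closed, positive $(p,p)$-current. If $K\subset\mathbb V$ is a compact set with $\mathcal H^{n-p}(K)=0$, then $T$ vanishes on $K$. In particular, if $\mathcal H^{n-p}(\operatorname{Supp}T)=0$, then $T=0$. -/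

import Mathlib

open MeasureTheory TopologicalSpace
open scoped Distributions

noncomputable section

/-- The space `𝕍 = ℝⁿ` with its Euclidean inner product. The second copy `𝕎` of `ℝⁿ` is
identified with `𝕍` through the fixed isomorphism `J`. -/
abbrev SuperBase (n : ℕ) : Type := EuclideanSpace ℝ (Fin n)

/-- Alternating `a`-covectors on `ℝⁿ`, that is, the values of `(a,0)`-forms. -/
abbrev PlainCovector (n a : ℕ) : Type := SuperBase n [⋀^Fin a]→L[ℝ] ℝ

/-- The values of super forms of bidegree `(a,b)`: the super covector
`∑ c_{KL} dx_K ∧ dξ_L` is encoded as `(v, w) ↦ ∑ c_{KL} dx_K(v) dξ_L(w)`, for an `a`-tuple `v` of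
vectors of `𝕍` and a `b`-tuple `w` of vectors of `𝕎 = 𝕍`. -/
abbrev SuperCovector (n a b : ℕ) : Type := SuperBase n [⋀^Fin a]→L[ℝ] PlainCovector n b

/-- `𝒟^{a,b}`: smooth compactly supported super forms of bidegree `(a,b)` with coefficients that
depend on `x ∈ 𝕍` only, with the usual (inductive limit) topology of test functions. -/
abbrev SuperTestForm (n a b : ℕ) : Type := 𝓓((⊤ : Opens (SuperBase n)), SuperCovector n a b)

/-- `𝒟_{p,q}`: super currents of bidegree `(p,q)` on `ℝⁿ`, the topological dual of
`𝒟^{n-p,n-q}`. -/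
abbrev SuperCurrent (n p q : ℕ) : Type := SuperTestForm n (n - p) (n - q) →L[ℝ] ℝ

namespace SuperForm

/-- The exterior derivative on smooth compactly supported `a`-forms on a normed space `E` with values
in a normed space `F`. -/
def extDerivTest (E F : Type) [NormedAddCommGroup E] [NormedSpace ℝ E]
    [NormedAddCommGroup F] [NormedSpace ℝ F] (a : ℕ) :
    𝓓((⊤ : Opens E), E [⋀^Fin a]→L[ℝ] F) →L[ℝ] 𝓓((⊤ : Opens E), E [⋀^Fin (a + 1)]→L[ℝ] F) :=
  let A : (E →L[ℝ] E [⋀^Fin a]→L[ℝ] F) →L[ℝ] (E [⋀^Fin (a + 1)]→L[ℝ] F) :=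
    ContinuousAlternatingMap.alternatizeUncurryFinCLM ℝ E F
  let D : 𝓓((⊤ : Opens E), E [⋀^Fin a]→L[ℝ] F) →L[ℝ]
      𝓓((⊤ : Opens E), E →L[ℝ] E [⋀^Fin a]→L[ℝ] F) :=
    TestFunction.fderivCLM ℝ ⊤ ⊤
  let P : 𝓓((⊤ : Opens E), E →L[ℝ] E [⋀^Fin a]→L[ℝ] F) →L[ℝ]
      𝓓((⊤ : Opens E), E [⋀^Fin (a + 1)]→L[ℝ] F) :=
    TestFunction.postcompCLM (𝕜 := ℝ) (Ω := (⊤ : Opens E)) (n := ⊤)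
      (F := E →L[ℝ] E [⋀^Fin a]→L[ℝ] F) (F' := E [⋀^Fin (a + 1)]→L[ℝ] F) A
  P.comp D

theorem extDerivTest_apply (E F : Type) [NormedAddCommGroup E] [NormedSpace ℝ E]
    [NormedAddCommGroup F] [NormedSpace ℝ F] (a : ℕ)
    (α : 𝓓((⊤ : Opens E), E [⋀^Fin a]→L[ℝ] F)) (x : E) :
    extDerivTest E F a α x = extDeriv (α : E → E [⋀^Fin a]→L[ℝ] F) x := by
  simp [extDerivTest, extDeriv]

/-- The operator `d : 𝒟^{a,b} → 𝒟^{a+1,b}`,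
`d (∑ α_{KL} dx_K ∧ dξ_L) = ∑ (∂α_{KL}/∂x_i) dx_i ∧ dx_K ∧ dξ_L`. It is the exterior derivative of
`α`, seen as an `a`-form on `𝕍` with values in the `b`-covectors of `𝕎`. -/
def d (n a b : ℕ) : SuperTestForm n a b →L[ℝ] SuperTestForm n (a + 1) b :=
  extDerivTest (SuperBase n) (PlainCovector n b) a

theorem d_apply (n a b : ℕ) (α : SuperTestForm n a b) (x : SuperBase n) :
    d n a b α x = extDeriv (α : SuperBase n → SuperCovector n a b) x :=
  extDerivTest_apply _ _ a α x

/-- The super covector `β ∧ J(γ)` of bidegree `(a,b)`, for covectors `β` of bidegree `(a,0)` and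
`γ` of bidegree `(b,0)`; bilinear in `(β, γ)`. -/
def wedgeJ (n a b : ℕ) (β : PlainCovector n a) (γ : PlainCovector n b) : SuperCovector n a b :=
  (ContinuousLinearMap.toSpanSingleton ℝ γ).compContinuousAlternatingMap β

theorem wedgeJ_apply (n a b : ℕ) (β : PlainCovector n a) (γ : PlainCovector n b)
    (v : Fin a → SuperBase n) (w : Fin b → SuperBase n) :
    wedgeJ n a b β γ v w = β v * γ w := by
  simp [wedgeJ]

theorem contDiff_tmul {E F : Type} [NormedAddCommGroup E] [NormedSpace ℝ E]
    [NormedAddCommGroup F] [NormedSpace ℝ F] {a : ℕ} {β : E → E [⋀^Fin a]→L[ℝ] ℝ} {γ : E → F}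
    (hβ : ContDiff ℝ (⊤ : ℕ∞) β) (hγ : ContDiff ℝ (⊤ : ℕ∞) γ) :
    ContDiff ℝ (⊤ : ℕ∞) fun x ↦
      (ContinuousLinearMap.toSpanSingleton ℝ (γ x)).compContinuousAlternatingMap (β x) := by
  let L : F →L[ℝ] (ℝ →L[ℝ] F) := (ContinuousLinearMap.toSpanSingletonCLE (𝕜 := ℝ) (E := F) : _)
  have h1 : ContDiff ℝ (⊤ : ℕ∞) fun x ↦
      ContinuousLinearMap.compContinuousAlternatingMapCLM ℝ E ℝ F (Fin a) (L (γ x)) :=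
    (ContinuousLinearMap.contDiff _).comp (L.contDiff.comp hγ)
  exact h1.clm_apply hβ

theorem contDiff_wedgeJ (n a b : ℕ) {β : SuperBase n → PlainCovector n a}
    {γ : SuperBase n → PlainCovector n b} (hβ : ContDiff ℝ (⊤ : ℕ∞) β)
    (hγ : ContDiff ℝ (⊤ : ℕ∞) γ) :
    ContDiff ℝ (⊤ : ℕ∞) fun x ↦ wedgeJ n a b (β x) (γ x) :=
  contDiff_tmul hβ hγ

theorem contDiff_smul_const {E F : Type} [NormedAddCommGroup E] [NormedSpace ℝ E]
    [NormedAddCommGroup F] [NormedSpace ℝ F] {φ : E → ℝ}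
    (hφ : ContDiff ℝ (⊤ : ℕ∞) φ) (c : F) : ContDiff ℝ (⊤ : ℕ∞) fun x ↦ φ x • c :=
  hφ.smul contDiff_const

/-- The test form `β ∧ J(β)` of bidegree `(m,m)`, for a test form `β` of bidegree `(m,0)`. -/
def wedgeJSelf (n m : ℕ) (β : 𝓓((⊤ : Opens (SuperBase n)), PlainCovector n m)) :
    SuperTestForm n m m where
  toFun x := wedgeJ n m m (β x) (β x)
  contDiff' := contDiff_wedgeJ n m m β.contDiff β.contDiff
  hasCompactSupport' := by
    refine β.hasCompactSupport.mono fun x hx hβ ↦ hx ?_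
    ext v w
    simp [wedgeJ_apply, hβ]
  tsupport_subset' := fun _ _ ↦ trivial

theorem wedgeJSelf_apply (n m : ℕ) (β : 𝓓((⊤ : Opens (SuperBase n)), PlainCovector n m))
    (x : SuperBase n) : wedgeJSelf n m β x = wedgeJ n m m (β x) (β x) :=
  rfl

/-- The test form `φ c`, for a scalar test function `φ` and a super covector `c`
(a form with constant coefficients). -/
def smulConst (n a b : ℕ) (c : SuperCovector n a b) (φ : 𝓓((⊤ : Opens (SuperBase n)), ℝ)) :
    SuperTestForm n a b where
  toFun x := φ x • c
  contDiff' := contDiff_smul_const φ.contDiff c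
  hasCompactSupport' := φ.hasCompactSupport.smul_right
  tsupport_subset' := fun _ _ ↦ trivial

theorem smulConst_apply (n a b : ℕ) (c : SuperCovector n a b)
    (φ : 𝓓((⊤ : Opens (SuperBase n)), ℝ)) (x : SuperBase n) :
    smulConst n a b c φ x = φ x • c :=
  rfl

end SuperForm

namespace SuperCurrent

/-- For a functional `T` on test forms of bidegree `(a,b)`, `dT = 0`, that is `⟨T, dα⟩ = 0` for all
test forms `α` of bidegree `(a-1,b)`. There are no such `α` if `a = 0`: a current of bidegree
`(n,q)` is closed. -/
def IsDClosed {n : ℕ} : {a b : ℕ} → (SuperTestForm n a b →L[ℝ] ℝ) → Prop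
  | 0, _, _ => True
  | a + 1, b, T => ∀ α : SuperTestForm n a b, T (SuperForm.d n a b α) = 0

/-- A current of bidegree `(p,p)` is symmetric: `T_{IJ} = T_{JI}` for its distribution
coefficients. Equivalently, `T` takes the same value on `∑ α_{KL} dx_K ∧ dξ_L` and on its transpose
`∑ α_{LK} dx_K ∧ dξ_L`; the signs that relate `T_{IJ}` to the values of `T` on
`φ dx_{Iᶜ} ∧ dξ_{Jᶜ}` are symmetric in `I` and `J`. -/
def IsSymmetric {n p : ℕ} (T : SuperCurrent n p p) : Prop :=
  ∀ α α' : SuperTestForm n (n - p) (n - p),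
    (∀ (x : SuperBase n) (v w : Fin (n - p) → SuperBase n), α' x v w = α x w v) → T α' = T α

/-- A current `T` of bidegree `(p,p)` is positive: it is symmetric, and
`⟨T, σ_{n-p} β ∧ J(β)⟩ ≥ 0` for every test form `β` of bidegree `(n-p,0)`, where
`σ_k = (-1)^{k(k-1)/2}`. -/
def IsPositive {n p : ℕ} (T : SuperCurrent n p p) : Prop :=
  IsSymmetric T ∧
    ∀ β : 𝓓((⊤ : Opens (SuperBase n)), PlainCovector n (n - p)),
      0 ≤ T ((-1 : ℝ) ^ ((n - p) * (n - p - 1) / 2) • SuperForm.wedgeJSelf n (n - p) β)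

/-- The support of a current: the complement of the largest open set `U` such that `⟨T, α⟩ = 0` for
all test forms `α` with support in `U`. -/
def supp {n p q : ℕ} (T : SuperCurrent n p q) : Set (SuperBase n) :=
  Distribution.dsupport T

/-- The current `T` has measure coefficients and vanishes on `K` (`T|_K = 0`): each coefficient
`φ ↦ ⟨T, φ c⟩` of `T`, for a constant super covector `c`, is a signed Radon measure with Jordan
decomposition `μ - ν`, and its total variation `μ + ν` is zero on `K`. The coefficients `T_{IJ}` are,
up to sign, those for the basis `c = dx_{Iᶜ} ∧ dξ_{Jᶜ}`. -/
def VanishesOn {n p q : ℕ} (T : SuperCurrent n p q) (K : Set (SuperBase n)) : Prop :=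
  ∀ c : SuperCovector n (n - p) (n - q), ∃ μ ν : Measure (SuperBase n),
    IsLocallyFiniteMeasure μ ∧ IsLocallyFiniteMeasure ν ∧ μ ⟂ₘ ν ∧
    (∀ φ : 𝓓((⊤ : Opens (SuperBase n)), ℝ),
      T (SuperForm.smulConst n (n - p) (n - q) c φ) = ∫ x, φ x ∂μ - ∫ x, φ x ∂ν) ∧
    (μ + ν) K = 0

end SuperCurrent

end

/-!
A closed positive current of bidegree `(p,p)` on `ℝⁿ` is, with `m = n - p`, a positive semidefinite
matrix of measures, indexed by `m`-covectors, each row of which is a closed `m`-dimensional current.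
The theorem rests on the fact that the projection to `ℝᵐ` of such an object is absolutely
continuous.

*Coefficients are measures.* Positivity gives `⟨T, φ β ∧ J(β)⟩ ≥ 0` for every constant covector `β`
and every test function `φ ≥ 0`, because `φ + ε χ²` is the square of a test function for a suitable
cutoff `χ`. Such a functional of `φ` is a Radon measure `μ_β` (`exists_measure_of_nonneg`), and by
symmetry and polarization every coefficient is a difference of two Radon measures
(`SuperCurrent.isSignedMeasureNullOn_coefficient`).

*Projection.* The covectors `β` with `μ_β(K) = 0` form a subspace, so it suffices to treat
`β = dx_I = π^* det`, where `π : ℝⁿ → ℝᵐ` consists of the coordinates `x_i`, `i ∈ I`. For a cutoff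
`φ`, a test function `ψ` on `ℝᵐ` and a vector `h`, closedness applied to
`φ · (ψ ∘ π) · π^*(ι_h det) ∧ J(β)` expresses `∫ φ · (∂_h ψ ∘ π) dμ_β` by terms in which only `φ` is
differentiated, hence bounds it by a constant times `sup |ψ|`. So the first order derivatives of the
image `λ` of `φ μ_β` under `π` are finite measures.

*Absolute continuity.* For such a measure `λ` on `ℝᵐ`, translation by `h` changes `∫ ψ dλ` by at
most `C ‖h‖ sup |ψ|`. Comparing `∫ ψ dλ` with its average over translations by vectors in a ball,
and taking `ψ` equal to `1` on a compact Lebesgue null set `N` and supported near it, gives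
`λ(N) = 0` (`measure_eq_zero_of_integral_fderiv_le`). If `ℋᵐ(K) = 0`, then `N = π(K)` is Lebesgue
null, because `π` is Lipschitz and `ℋᵐ` is Lebesgue measure on `ℝᵐ`; therefore `μ_β(K) = 0`.

*Support.* If `ℋᵐ(Supp T) = 0`, a test form is cut off near the compact part of `Supp T` that meets
its support. The piece near this set contributes arbitrarily little, as the coefficients do not
charge the set, and the other piece is supported where `T` vanishes.
-/

/-! ### Test functions -/

noncomputable section TestFunctions

open Set Filter Topology

variable {E : Type*} [NormedAddCommGroup E] [NormedSpace ℝ E]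

/-- The product of a smooth function and a test function. -/
def TestFunction.smoothMul (χ : E → ℝ) (hχ : ContDiff ℝ (⊤ : ℕ∞) χ) (φ : 𝓓((⊤ : Opens E), ℝ)) :
    𝓓((⊤ : Opens E), ℝ) where
  toFun x := χ x * φ x
  contDiff' := hχ.mul φ.contDiff
  hasCompactSupport' := φ.hasCompactSupport.mul_left
  tsupport_subset' := fun _ _ ↦ trivial

theorem TestFunction.smoothMul_apply (χ : E → ℝ) (hχ : ContDiff ℝ (⊤ : ℕ∞) χ)
    (φ : 𝓓((⊤ : Opens E), ℝ)) (x : E) : TestFunction.smoothMul χ hχ φ x = χ x * φ x :=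
  rfl

theorem TestFunction.smoothMul_add_smoothMul_one_sub (χ φ : 𝓓((⊤ : Opens E), ℝ)) :
    TestFunction.smoothMul χ χ.contDiff φ +
      TestFunction.smoothMul (fun x ↦ 1 - χ x) (contDiff_const.sub χ.contDiff) φ = φ := by
  ext x
  change χ x * φ x + (1 - χ x) * φ x = φ x
  ring

theorem TestFunction.tsupport_smoothMul_one_sub_subset {χ : 𝓓((⊤ : Opens E), ℝ)} {K : Set E}
    (h : ∀ᶠ x in 𝓝ˢ K, χ x = 1) (φ : 𝓓((⊤ : Opens E), ℝ)) :
    tsupport (TestFunction.smoothMul (fun x ↦ 1 - χ x) (contDiff_const.sub χ.contDiff) φ) ⊆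
      tsupport φ \ K := by
  refine fun x hx ↦ ⟨tsupport_mul_subset_right hx, fun hxK ↦ ?_⟩
  refine notMem_tsupport_iff_eventuallyEq.2 ?_ hx
  filter_upwards [(mem_nhdsSet_iff_forall.1 h) x hxK] with y hy
  change (1 - χ y) * φ y = 0
  rw [show χ y = 1 from hy, sub_self, zero_mul]

theorem TestFunction.integrable_of_isLocallyFiniteMeasure [MeasurableSpace E] [BorelSpace E]
    {μ : Measure E} [IsLocallyFiniteMeasure μ] (φ : 𝓓((⊤ : Opens E), ℝ)) : Integrable φ μ :=
  φ.continuous.integrable_of_hasCompactSupport φ.hasCompactSupport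

theorem exists_testFunction_eq_one [FiniteDimensional ℝ E] {K U : Set E} (hK : IsCompact K)
    (hU : IsOpen U) (hKU : K ⊆ U) :
    ∃ φ : 𝓓((⊤ : Opens E), ℝ), (∀ᶠ x in 𝓝ˢ K, φ x = 1) ∧ tsupport φ ⊆ U ∧
      ∀ x, φ x ∈ Icc (0 : ℝ) 1 := by
  obtain ⟨L, hL, hKL, hLU⟩ := exists_compact_between hK hU hKU
  obtain ⟨f, h1, h0, hf⟩ := exists_contMDiffMap_one_nhds_of_subset_interior (n := (⊤ : ℕ∞))
    (modelWithCornersSelf ℝ E) hK.isClosed hKL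
  have hs : tsupport f ⊆ L :=
    closure_minimal (fun x hx ↦ by_contra fun hxL ↦ hx (h0 x hxL)) hL.isClosed
  exact ⟨⟨f, f.contMDiff.contDiff, hL.of_isClosed_subset (isClosed_tsupport _) hs,
    fun _ _ ↦ trivial⟩, h1, hs.trans hLU, hf⟩

/-- Nonnegative test functions are limits of squares of test functions: the square root of
`φ + ε χ²` is smooth when `χ` is nonnegative and equals `1` near the support of `φ`. -/
theorem exists_testFunction_sq_eq (φ χ : 𝓓((⊤ : Opens E), ℝ))
    (hφ : ∀ x, 0 ≤ φ x) (hχ : ∀ x, 0 ≤ χ x) (h1 : ∀ x ∈ tsupport φ, χ x = 1) {ε : ℝ} (hε : 0 < ε) :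
    ∃ ψ : 𝓓((⊤ : Opens E), ℝ), ∀ x, ψ x ^ 2 = φ x + ε * χ x ^ 2 := by
  have hnn : ∀ x, 0 ≤ φ x + ε * χ x ^ 2 := fun x ↦ by have := hφ x; positivity
  refine ⟨⟨fun x ↦ Real.sqrt (φ x + ε * χ x ^ 2), ?_, ?_, fun _ _ ↦ trivial⟩,
    fun x ↦ Real.sq_sqrt (hnn x)⟩
  · rw [contDiff_iff_contDiffAt]
    intro x
    by_cases hx : x ∈ tsupport φ
    · refine ContDiffAt.sqrt ?_ ?_
      · exact (φ.contDiff.add (contDiff_const.mul (χ.contDiff.pow 2))).contDiffAt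
      · have := hφ x
        rw [h1 x hx]
        positivity
    · have : (fun x ↦ Real.sqrt (φ x + ε * χ x ^ 2)) =ᶠ[𝓝 x] fun x ↦ Real.sqrt ε * χ x := by
        filter_upwards [(isClosed_tsupport φ).isOpen_compl.mem_nhds hx] with y hy
        rw [image_eq_zero_of_notMem_tsupport hy, zero_add, Real.sqrt_mul hε.le,
          Real.sqrt_sq (hχ y)]
      exact (contDiff_const.mul χ.contDiff).contDiffAt.congr_of_eventuallyEq this
  · refine HasCompactSupport.intro (φ.hasCompactSupport.isCompact.union
      χ.hasCompactSupport.isCompact) fun x hx ↦ ?_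
    rw [mem_union, not_or] at hx
    simp [image_eq_zero_of_notMem_tsupport hx.1, image_eq_zero_of_notMem_tsupport hx.2]

/-- A positive linear functional on test functions is integration against a Radon measure. No
continuity is needed: the functional extends to a positive functional on `C_c` by M. Riesz. -/
theorem exists_measure_of_nonneg [FiniteDimensional ℝ E] [MeasurableSpace E] [BorelSpace E]
    (Λ : 𝓓((⊤ : Opens E), ℝ) →ₗ[ℝ] ℝ) (hΛ : ∀ φ, (∀ x, 0 ≤ φ x) → 0 ≤ Λ φ) :
    ∃ μ : Measure E, IsLocallyFiniteMeasure μ ∧ ∀ φ, Λ φ = ∫ x, φ x ∂μ := by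
  let ι : 𝓓((⊤ : Opens E), ℝ) →ₗ[ℝ] CompactlySupportedContinuousMap E ℝ :=
    { toFun := fun φ ↦ ⟨⟨φ, φ.continuous⟩, φ.hasCompactSupport⟩
      map_add' := fun _ _ ↦ rfl
      map_smul' := fun _ _ ↦ rfl }
  have hι : Function.Injective ι := fun φ ψ h ↦ by
    ext x
    exact congrArg (fun f : CompactlySupportedContinuousMap E ℝ ↦ f x) h
  let e := LinearEquiv.ofInjective ι hι
  have he : ∀ y : LinearMap.range ι, ∀ x, e.symm y x =
      (y : CompactlySupportedContinuousMap E ℝ) x := by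
    intro y x
    conv_rhs => rw [← e.apply_symm_apply y]
    rfl
  let f : CompactlySupportedContinuousMap E ℝ →ₗ.[ℝ] ℝ :=
    ⟨LinearMap.range ι, Λ ∘ₗ e.symm.toLinearMap⟩
  let C : PointedCone ℝ (CompactlySupportedContinuousMap E ℝ) :=
    { carrier := {y | ∀ x, 0 ≤ y x}
      add_mem' := fun ha hb x ↦ add_nonneg (ha x) (hb x)
      zero_mem' := fun _ ↦ le_rfl
      smul_mem' := fun c y hy x ↦ mul_nonneg c.2 (hy x) }
  obtain ⟨g, hg, hpos⟩ := riesz_extension C f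
    (fun y hy ↦ hΛ _ fun x ↦ (hy x).trans_eq (he y x).symm) (fun y ↦ by
      obtain ⟨χ, h1, -, h01⟩ := exists_testFunction_eq_one y.hasCompactSupport isOpen_univ
        (subset_univ _)
      obtain ⟨C, hC⟩ := y.continuous.bounded_above_of_compact_support y.hasCompactSupport
      -- `C χ` dominates `-y` when `C` bounds `|y|` and `χ = 1` on the support of `y`
      refine ⟨⟨ι (C • χ), LinearMap.mem_range_self _ _⟩, ?_⟩
      change ∀ x, (0 : ℝ) ≤ C * χ x + y x
      intro x
      by_cases hx : x ∈ tsupport y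
      · rw [h1.self_of_nhdsSet x hx, mul_one]
        exact neg_le_iff_add_nonneg'.1 (abs_le.1 (hC x)).1
      · rw [image_eq_zero_of_notMem_tsupport hx, add_zero]
        exact mul_nonneg ((norm_nonneg _).trans (hC x)) (h01 x).1)
  let G : CompactlySupportedContinuousMap E ℝ →ₚ[ℝ] ℝ := PositiveLinearMap.mk₀ g hpos
  refine ⟨RealRMK.rieszMeasure G, inferInstance, fun φ ↦ ?_⟩
  have h2 := RealRMK.integral_rieszMeasure G (ι φ)
  have h3 := hg (e φ)
  have h4 : f (e φ) = Λ φ := congrArg Λ (e.symm_apply_apply φ)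
  rw [h4] at h3
  exact h3.symm.trans h2.symm

theorem measure_le_of_integral_testFunction_le [FiniteDimensional ℝ E] [MeasurableSpace E]
    [BorelSpace E] {μ ν : Measure E} [IsLocallyFiniteMeasure μ] [IsLocallyFiniteMeasure ν]
    (h : ∀ φ : 𝓓((⊤ : Opens E), ℝ), (∀ x, 0 ≤ φ x) → ∫ x, φ x ∂μ ≤ ∫ x, φ x ∂ν)
    {K : Set E} (hK : IsCompact K) : μ K ≤ ν K := by
  refine ENNReal.le_of_forall_pos_le_add fun ε hε _ ↦ ?_
  have hεν : (ε : ENNReal) ≠ 0 := by simpa using hε.ne'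
  obtain ⟨V, hKV, hV, hVν⟩ := exists_isOpen_le_add K ν hεν
  have hVfin : ν V ≠ ⊤ := (hVν.trans_lt (by
    exact ENNReal.add_lt_top.2 ⟨hK.measure_lt_top, ENNReal.coe_lt_top⟩)).ne
  obtain ⟨φ, h1, hφV, h01⟩ := exists_testFunction_eq_one hK hV hKV
  have hle : μ.real K ≤ ν.real V := by
    calc μ.real K = ∫ x, K.indicator 1 x ∂μ := (integral_indicator_one hK.measurableSet).symm
      _ ≤ ∫ x, φ x ∂μ := by
        refine integral_mono ?_ φ.integrable_of_isLocallyFiniteMeasure fun x ↦ ?_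
        · exact (continuousOn_const.integrableOn_compact hK).integrable_indicator hK.measurableSet
        · by_cases hx : x ∈ K
          · simp [hx, h1.self_of_nhdsSet x hx]
          · simp [hx, (h01 x).1]
      _ ≤ ∫ x, φ x ∂ν := h φ fun x ↦ (h01 x).1
      _ ≤ ∫ x, V.indicator 1 x ∂ν := by
        refine integral_mono φ.integrable_of_isLocallyFiniteMeasure ?_ fun x ↦ ?_
        · exact (integrableOn_const hVfin).integrable_indicator hV.measurableSet
        · by_cases hx : x ∈ V
          · simp [hx, (h01 x).2]
          · simp [hx, image_eq_zero_of_notMem_tsupport fun h ↦ hx (hφV h)]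
      _ = ν.real V := integral_indicator_one hV.measurableSet
  have hμK : μ K ≠ ⊤ := hK.measure_lt_top.ne
  exact ((ENNReal.toReal_le_toReal hμK hVfin).1 hle).trans hVν

/-- A linear functional on test functions vanishes on a compact set `K`, in the sense of vanishing
on a neighbourhood of it, as soon as it vanishes near each point of `K`. -/
theorem exists_isOpen_forall_eq_zero [FiniteDimensional ℝ E] (Λ : 𝓓((⊤ : Opens E), ℝ) →ₗ[ℝ] ℝ)
    {K : Set E} (hK : IsCompact K)
    (h : ∀ x ∈ K, ∃ U, IsOpen U ∧ x ∈ U ∧ ∀ φ : 𝓓((⊤ : Opens E), ℝ), tsupport φ ⊆ U → Λ φ = 0) :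
    ∃ U, IsOpen U ∧ K ⊆ U ∧ ∀ φ : 𝓓((⊤ : Opens E), ℝ), tsupport φ ⊆ U → Λ φ = 0 := by
  refine hK.induction_on (p := fun s ↦ ∃ U, IsOpen U ∧ s ⊆ U ∧
    ∀ φ : 𝓓((⊤ : Opens E), ℝ), tsupport φ ⊆ U → Λ φ = 0) ?_ ?_ ?_ ?_
  · refine ⟨∅, isOpen_empty, subset_rfl, fun φ hφ ↦ ?_⟩
    have : φ = 0 := by
      ext x
      exact image_eq_zero_of_notMem_tsupport fun hx ↦ hφ hx
    rw [this, map_zero]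
  · rintro s t hst ⟨U, hU, htU, h⟩
    exact ⟨U, hU, hst.trans htU, h⟩
  · rintro s t ⟨U, hU, hsU, hU0⟩ ⟨V, hV, htV, hV0⟩
    refine ⟨U ∪ V, hU.union hV, union_subset_union hsU htV, fun φ hφ ↦ ?_⟩
    -- split `φ` by a cutoff equal to `1` near the part of its support outside `V`
    obtain ⟨χ, h1, hχU, -⟩ := exists_testFunction_eq_one (K := tsupport φ \ V) (U := U)
      (φ.hasCompactSupport.isCompact.diff hV) hU fun x hx ↦ (hφ hx.1).resolve_right hx.2
    rw [← TestFunction.smoothMul_add_smoothMul_one_sub χ φ, map_add,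
      hU0 _ (tsupport_mul_subset_left.trans hχU), hV0, add_zero]
    intro x hx
    obtain ⟨hxφ, hxV⟩ := TestFunction.tsupport_smoothMul_one_sub_subset h1 φ hx
    exact by_contra fun h ↦ hxV ⟨hxφ, h⟩
  · intro x hx
    obtain ⟨U, hU, hxU, h0⟩ := h x hx
    exact ⟨U, mem_nhdsWithin_of_mem_nhds (hU.mem_nhds hxU), U, hU, subset_rfl, h0⟩

end TestFunctions

/-! ### Differences of locally finite measures -/

noncomputable section SignedMeasures

open Set Filter Topology

variable {E : Type*} [NormedAddCommGroup E] [NormedSpace ℝ E] [MeasurableSpace E]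

theorem isLocallyFiniteMeasure_add {E : Type*} [TopologicalSpace E] [MeasurableSpace E]
    (μ ν : Measure E) [IsLocallyFiniteMeasure μ] [IsLocallyFiniteMeasure ν] :
    IsLocallyFiniteMeasure (μ + ν) := by
  refine ⟨fun x ↦ ?_⟩
  obtain ⟨s, hs, hμ⟩ := μ.finiteAt_nhds x
  obtain ⟨t, ht, hν⟩ := ν.finiteAt_nhds x
  refine ⟨s ∩ t, inter_mem hs ht, ENNReal.add_lt_top.2 ⟨?_, ?_⟩⟩
  · exact (measure_mono inter_subset_left).trans_lt hμ
  · exact (measure_mono inter_subset_right).trans_lt hν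

/-- The functional `Λ` on test functions is a signed Radon measure, given as a difference of two
locally finite measures that both vanish on `K`. -/
def IsSignedMeasureNullOn (Λ : 𝓓((⊤ : Opens E), ℝ) →ₗ[ℝ] ℝ) (K : Set E) : Prop :=
  ∃ μ ν : Measure E, IsLocallyFiniteMeasure μ ∧ IsLocallyFiniteMeasure ν ∧
    (∀ φ, Λ φ = ∫ x, φ x ∂μ - ∫ x, φ x ∂ν) ∧ μ K = 0 ∧ ν K = 0

namespace IsSignedMeasureNullOn

variable {Λ Λ' : 𝓓((⊤ : Opens E), ℝ) →ₗ[ℝ] ℝ} {K : Set E}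

theorem zero : IsSignedMeasureNullOn (0 : 𝓓((⊤ : Opens E), ℝ) →ₗ[ℝ] ℝ) K :=
  ⟨0, 0, inferInstance, inferInstance, by simp, by simp, by simp⟩

theorem neg (h : IsSignedMeasureNullOn Λ K) : IsSignedMeasureNullOn (-Λ) K := by
  obtain ⟨μ, ν, hμ, hν, hΛ, hμK, hνK⟩ := h
  exact ⟨ν, μ, hν, hμ, fun φ ↦ by simp [hΛ], hνK, hμK⟩

theorem add [BorelSpace E] (h : IsSignedMeasureNullOn Λ K) (h' : IsSignedMeasureNullOn Λ' K) :
    IsSignedMeasureNullOn (Λ + Λ') K := by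
  obtain ⟨μ, ν, hμ, hν, hΛ, hμK, hνK⟩ := h
  obtain ⟨μ', ν', hμ', hν', hΛ', hμK', hνK'⟩ := h'
  refine ⟨μ + μ', ν + ν', isLocallyFiniteMeasure_add _ _, isLocallyFiniteMeasure_add _ _,
    fun φ ↦ ?_, by simp [hμK, hμK'], by simp [hνK, hνK']⟩
  rw [integral_add_measure φ.integrable_of_isLocallyFiniteMeasure
      φ.integrable_of_isLocallyFiniteMeasure,
    integral_add_measure φ.integrable_of_isLocallyFiniteMeasure
      φ.integrable_of_isLocallyFiniteMeasure, LinearMap.add_apply, hΛ, hΛ']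
  ring

theorem smul_of_nonneg (h : IsSignedMeasureNullOn Λ K) {r : ℝ} (hr : 0 ≤ r) :
    IsSignedMeasureNullOn (r • Λ) K := by
  obtain ⟨μ, ν, hμ, hν, hΛ, hμK, hνK⟩ := h
  refine ⟨r.toNNReal • μ, r.toNNReal • ν, inferInstance, inferInstance, fun φ ↦ ?_,
    by simp [hμK], by simp [hνK]⟩
  simp only [LinearMap.smul_apply, hΛ, integral_smul_nnreal_measure, NNReal.smul_def,
    Real.coe_toNNReal _ hr, smul_eq_mul]
  ring

theorem smul (h : IsSignedMeasureNullOn Λ K) (r : ℝ) : IsSignedMeasureNullOn (r • Λ) K := by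
  rcases le_total 0 r with hr | hr
  · exact h.smul_of_nonneg hr
  · have hΛ : r • Λ = -((-r) • Λ) := LinearMap.ext fun φ ↦ by simp
    exact hΛ ▸ (h.smul_of_nonneg (neg_nonneg.2 hr)).neg

theorem sum [BorelSpace E] {ι : Type*} (s : Finset ι) {Λ : ι → 𝓓((⊤ : Opens E), ℝ) →ₗ[ℝ] ℝ}
    (h : ∀ i ∈ s, IsSignedMeasureNullOn (Λ i) K) : IsSignedMeasureNullOn (∑ i ∈ s, Λ i) K :=
  Finset.sum_induction _ (IsSignedMeasureNullOn · K) (fun _ _ ↦ add) zero h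

/-- Integration against `μ - ν` is bounded by the supremum norm on products with a fixed test
function. -/
theorem exists_bound [BorelSpace E] (h : IsSignedMeasureNullOn Λ K) (φ : 𝓓((⊤ : Opens E), ℝ)) :
    ∃ C, ∀ (χ : E → ℝ) (hχ : ContDiff ℝ (⊤ : ℕ∞) χ), (∀ x, |χ x| ≤ 1) →
      |Λ (TestFunction.smoothMul χ hχ φ)| ≤ C := by
  obtain ⟨μ, ν, hμ, hν, hΛ, -, -⟩ := h
  have key : ∀ (ρ : Measure E) [IsLocallyFiniteMeasure ρ] (χ : E → ℝ)
      (hχ : ContDiff ℝ (⊤ : ℕ∞) χ), (∀ x, |χ x| ≤ 1) →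
      |∫ x, TestFunction.smoothMul χ hχ φ x ∂ρ| ≤ ∫ x, |φ x| ∂ρ := by
    intro ρ _ χ hχ h1
    rw [← Real.norm_eq_abs]
    refine norm_integral_le_of_norm_le (φ.integrable_of_isLocallyFiniteMeasure (μ := ρ)).abs
      (ae_of_all _ fun x ↦ ?_)
    rw [TestFunction.smoothMul_apply, norm_mul]
    exact mul_le_of_le_one_left (norm_nonneg _) (h1 x)
  refine ⟨∫ x, |φ x| ∂μ + ∫ x, |φ x| ∂ν, fun χ hχ h1 ↦ ?_⟩
  rw [hΛ]
  exact (abs_sub _ _).trans (add_le_add (key μ χ hχ h1) (key ν χ hχ h1))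

/-- The Jordan decomposition: the two measures can be chosen mutually singular. Their densities with
respect to `μ + ν` are the positive parts of the differences of the densities of `μ` and `ν`. -/
theorem exists_mutuallySingular [FiniteDimensional ℝ E] [BorelSpace E]
    (h : IsSignedMeasureNullOn Λ K) :
    ∃ μ ν : Measure E, IsLocallyFiniteMeasure μ ∧ IsLocallyFiniteMeasure ν ∧ μ ⟂ₘ ν ∧
      (∀ φ, Λ φ = ∫ x, φ x ∂μ - ∫ x, φ x ∂ν) ∧ (μ + ν) K = 0 := by
  obtain ⟨μ, ν, hμ, hν, hΛ, hμK, hνK⟩ := h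
  have := isLocallyFiniteMeasure_add μ ν
  set σ := μ + ν with hσ
  set f := μ.rnDeriv σ with hf
  set g := ν.rnDeriv σ with hg
  have hfm : Measurable f := Measure.measurable_rnDeriv _ _
  have hgm : Measurable g := Measure.measurable_rnDeriv _ _
  have hμf : σ.withDensity f = μ :=
    Measure.withDensity_rnDeriv_eq _ _ (Measure.le_add_right le_rfl).absolutelyContinuous
  have hνg : σ.withDensity g = ν :=
    Measure.withDensity_rnDeriv_eq _ _ (Measure.le_add_left le_rfl).absolutelyContinuous
  have hμ' : σ.withDensity (f - g) ≤ μ := by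
    conv_rhs => rw [← hμf]
    exact withDensity_mono (ae_of_all _ fun _ ↦ tsub_le_self)
  have hν' : σ.withDensity (g - f) ≤ ν := by
    conv_rhs => rw [← hνg]
    exact withDensity_mono (ae_of_all _ fun _ ↦ tsub_le_self)
  have : IsLocallyFiniteMeasure (σ.withDensity (f - g)) := Measure.isLocallyFiniteMeasure_of_le hμ'
  have : IsLocallyFiniteMeasure (σ.withDensity (g - f)) := Measure.isLocallyFiniteMeasure_of_le hν'
  refine ⟨σ.withDensity (f - g), σ.withDensity (g - f), inferInstance, inferInstance, ?_, ?_, ?_⟩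
  · refine ⟨{x | f x ≤ g x}, measurableSet_le hfm hgm, ?_, ?_⟩
    · rw [withDensity_apply _ (measurableSet_le hfm hgm),
        setLIntegral_eq_zero_iff (measurableSet_le hfm hgm) (hfm.sub hgm)]
      exact ae_of_all _ fun x hx ↦ tsub_eq_zero_of_le hx
    · rw [withDensity_apply _ (measurableSet_le hfm hgm).compl,
        setLIntegral_eq_zero_iff (measurableSet_le hfm hgm).compl (hgm.sub hfm)]
      exact ae_of_all _ fun x hx ↦ tsub_eq_zero_of_le (not_le.1 (show ¬ f x ≤ g x from hx)).le
  · intro φ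
    have hsum : μ + σ.withDensity (g - f) = ν + σ.withDensity (f - g) := by
      have h1 : σ.withDensity f + σ.withDensity (g - f) =
          σ.withDensity g + σ.withDensity (f - g) := by
        rw [← withDensity_add_left hfm, ← withDensity_add_left hgm]
        congr 1
        ext x
        simp only [Pi.add_apply, Pi.sub_apply, add_tsub_eq_max, max_comm]
      rwa [hμf, hνg] at h1
    have hint := congrArg (fun ρ : Measure E ↦ ∫ x, φ x ∂ρ) hsum
    beta_reduce at hint
    rw [integral_add_measure φ.integrable_of_isLocallyFiniteMeasure
        φ.integrable_of_isLocallyFiniteMeasure,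
      integral_add_measure φ.integrable_of_isLocallyFiniteMeasure
        φ.integrable_of_isLocallyFiniteMeasure] at hint
    rw [hΛ]
    linarith
  · rw [Measure.add_apply, add_eq_zero]
    exact ⟨le_antisymm ((hμ' K).trans_eq hμK) zero_le, le_antisymm ((hν' K).trans_eq hνK)
      zero_le⟩

end IsSignedMeasureNullOn

/-- A functional on test functions that is a difference of measures vanishing on the compact set `K`
only sees the values of a test function off `K`: it is zero on `φ` as soon as it vanishes on test
functions whose support is contained in that of `φ` and avoids `K`. -/
theorem IsSignedMeasureNullOn.apply_eq_zero [FiniteDimensional ℝ E] [BorelSpace E]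
    {Λ : 𝓓((⊤ : Opens E), ℝ) →ₗ[ℝ] ℝ} {K : Set E} (h : IsSignedMeasureNullOn Λ K)
    (hK : IsCompact K) (φ : 𝓓((⊤ : Opens E), ℝ))
    (h0 : ∀ ψ : 𝓓((⊤ : Opens E), ℝ), tsupport ψ ⊆ tsupport φ \ K → Λ ψ = 0) : Λ φ = 0 := by
  obtain ⟨μ, ν, hμ, hν, hΛ, hμK, hνK⟩ := h
  obtain ⟨C, hC⟩ := φ.continuous.bounded_above_of_compact_support φ.hasCompactSupport
  have hC0 : 0 ≤ C := (norm_nonneg _).trans (hC 0)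
  have := isLocallyFiniteMeasure_add μ ν
  have key : ∀ ε : ℝ, 0 < ε → |Λ φ| ≤ C * (2 * ε) := by
    intro ε hε
    obtain ⟨V, hKV, hV, hVlt⟩ := K.exists_isOpen_lt_of_lt (μ := μ + ν) (ENNReal.ofReal ε)
      (by simpa [hμK, hνK] using hε)
    have hμV : μ V ≤ ENNReal.ofReal ε := (Measure.le_add_right le_rfl V).trans hVlt.le
    have hνV : ν V ≤ ENNReal.ofReal ε := (Measure.le_add_left le_rfl V).trans hVlt.le
    obtain ⟨χ, h1, hχV, h01⟩ := exists_testFunction_eq_one hK hV hKV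
    have hfar := h0 _ (TestFunction.tsupport_smoothMul_one_sub_subset h1 φ)
    have hnear : ∀ (ρ : Measure E) [IsLocallyFiniteMeasure ρ], ρ V ≤ ENNReal.ofReal ε →
        |∫ x, TestFunction.smoothMul χ χ.contDiff φ x ∂ρ| ≤ C * ε := by
      intro ρ _ hρ
      have hρ' : ρ V < ⊤ := hρ.trans_lt ENNReal.ofReal_lt_top
      have hsub : ∀ x, x ∉ V → TestFunction.smoothMul χ χ.contDiff φ x = 0 := fun x hx ↦ by
        rw [TestFunction.smoothMul_apply,
          image_eq_zero_of_notMem_tsupport fun h ↦ hx (hχV h), zero_mul]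
      rw [← Real.norm_eq_abs, ← setIntegral_eq_integral_of_forall_compl_eq_zero hsub]
      refine (norm_setIntegral_le_of_norm_le_const (C := C) hρ' fun x _ ↦ ?_).trans ?_
      · rw [TestFunction.smoothMul_apply, norm_mul, Real.norm_of_nonneg (h01 x).1]
        exact (mul_le_of_le_one_left (norm_nonneg _) (h01 x).2).trans (hC x)
      · exact mul_le_mul_of_nonneg_left (ENNReal.toReal_le_of_le_ofReal hε.le hρ) hC0
    rw [← TestFunction.smoothMul_add_smoothMul_one_sub χ φ, map_add, hfar, add_zero, hΛ]
    linarith [abs_sub (∫ x, TestFunction.smoothMul χ χ.contDiff φ x ∂μ)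
      (∫ x, TestFunction.smoothMul χ χ.contDiff φ x ∂ν), hnear μ hμV, hnear ν hνV]
  rw [← abs_nonpos_iff]
  refine le_of_forall_pos_le_add fun δ hδ ↦ ?_
  have := key (δ / (2 * (C + 1))) (by positivity)
  refine this.trans ?_
  rw [zero_add, show C * (2 * (δ / (2 * (C + 1)))) = δ * (C / (C + 1)) by field_simp]
  exact mul_le_of_le_one_right hδ.le ((div_le_one (by positivity)).2 (by linarith))

end SignedMeasures

/-! ### Measures with bounded derivatives -/

section BoundedDerivatives

open Set Filter Topology

variable {F : Type*} [NormedAddCommGroup F] [NormedSpace ℝ F] [MeasurableSpace F] [BorelSpace F]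

theorem TestFunction.integrable_fderiv_apply {μ : Measure F} [IsLocallyFiniteMeasure μ]
    (ψ : 𝓓((⊤ : Opens F), ℝ)) (h : F) : Integrable (fun y ↦ fderiv ℝ ψ y h) μ :=
  ((ψ.contDiff.continuous_fderiv (by simp)).clm_apply
    continuous_const).integrable_of_hasCompactSupport (ψ.hasCompactSupport.fderiv_apply ℝ h)

/-- A measure whose derivatives are measures depends in a Lipschitz way on translations. -/
theorem abs_integral_translate_sub_le {μ : Measure F} [IsFiniteMeasure μ] {C : ℝ}
    (hC : ∀ (h : F) (ψ : 𝓓((⊤ : Opens F), ℝ)), (∀ y, |ψ y| ≤ 1) →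
      |∫ y, fderiv ℝ ψ y h ∂μ| ≤ C * ‖h‖)
    (ψ : 𝓓((⊤ : Opens F), ℝ)) (hψ : ∀ y, |ψ y| ≤ 1) (h : F) :
    |∫ y, ψ (y + h) ∂μ - ∫ y, ψ y ∂μ| ≤ C * ‖h‖ := by
  have hd : ∀ (y : F) (t : ℝ),
      HasDerivAt (fun t : ℝ ↦ ψ (y + t • h)) (fderiv ℝ ψ (y + t • h) h) t := by
    intro y t
    have h1 : HasDerivAt (fun t : ℝ ↦ y + t • h) h t := by
      simpa using ((hasDerivAt_id t).smul_const h).const_add y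
    exact ((ψ.contDiff.differentiable (by simp)) _).hasFDerivAt.comp_hasDerivAt t h1
  have hcont : Continuous (fun y ↦ fderiv ℝ ψ y h) :=
    (ψ.contDiff.continuous_fderiv (by simp)).clm_apply continuous_const
  obtain ⟨B, hB⟩ := hcont.bounded_above_of_compact_support (ψ.hasCompactSupport.fderiv_apply ℝ h)
  have hderiv : ∀ t : ℝ, HasDerivAt (fun t : ℝ ↦ ∫ y, ψ (y + t • h) ∂μ)
      (∫ y, fderiv ℝ ψ (y + t • h) h ∂μ) t := by
    intro t
    refine (hasDerivAt_integral_of_dominated_loc_of_deriv_le (bound := fun _ ↦ B) univ_mem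
      (Eventually.of_forall fun s ↦ ?_) ?_ ?_ (ae_of_all _ fun y s _ ↦ hB _)
      (integrable_const _) (ae_of_all _ fun y s _ ↦ hd y s)).2
    · exact (ψ.continuous.comp (continuous_id.add continuous_const)).aestronglyMeasurable
    · exact Integrable.of_bound
        (ψ.continuous.comp (continuous_id.add continuous_const)).aestronglyMeasurable 1
        (ae_of_all _ fun y ↦ hψ _)
    · exact (hcont.comp (continuous_id.add continuous_const)).aestronglyMeasurable
  have hbound : ∀ t : ℝ, ‖∫ y, fderiv ℝ ψ (y + t • h) h ∂μ‖ ≤ C * ‖h‖ := by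
    intro t
    let ψt : 𝓓((⊤ : Opens F), ℝ) := ⟨fun y ↦ ψ (y + t • h),
      ψ.contDiff.comp (contDiff_id.add contDiff_const),
      ψ.hasCompactSupport.comp_homeomorph (Homeomorph.addRight (t • h)), fun _ _ ↦ trivial⟩
    have := hC h ψt fun y ↦ hψ _
    have he : ∀ y, fderiv ℝ ψt y = fderiv ℝ ψ (y + t • h) := fun y ↦
      fderiv_comp_add_right (f := ψ) (t • h)
    simpa only [he, ← Real.norm_eq_abs] using this
  have := norm_image_sub_le_of_norm_deriv_le_segment_01' (f := fun t : ℝ ↦ ∫ y, ψ (y + t • h) ∂μ)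
    (fun t _ ↦ (hderiv t).hasDerivWithinAt) fun t _ ↦ hbound t
  simpa using this

variable [FiniteDimensional ℝ F]

/-- If the directional derivatives of a measure are measures, their total masses depend at most
linearly on the direction. -/
theorem exists_forall_integral_fderiv_le {μ : Measure F} [IsLocallyFiniteMeasure μ]
    (H : ∀ h : F, ∃ C, ∀ ψ : 𝓓((⊤ : Opens F), ℝ), (∀ y, |ψ y| ≤ 1) →
      |∫ y, fderiv ℝ ψ y h ∂μ| ≤ C) :
    ∃ C, 0 ≤ C ∧ ∀ (h : F) (ψ : 𝓓((⊤ : Opens F), ℝ)), (∀ y, |ψ y| ≤ 1) →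
      |∫ y, fderiv ℝ ψ y h ∂μ| ≤ C * ‖h‖ := by
  choose C hC using H
  let b := Module.finBasis ℝ F
  have hC0 : ∀ h, 0 ≤ C h := fun h ↦ by simpa using hC h 0 (by simp)
  refine ⟨∑ i, ‖(b.coord i).toContinuousLinearMap‖ * C (b i),
    Finset.sum_nonneg fun i _ ↦ mul_nonneg (norm_nonneg _) (hC0 _), fun h ψ hψ ↦ ?_⟩
  have hexp : ∀ y, fderiv ℝ ψ y h = ∑ i, b.coord i h * fderiv ℝ ψ y (b i) := by
    intro y
    calc fderiv ℝ ψ y h = fderiv ℝ ψ y (∑ i, b.repr h i • b i) := by rw [b.sum_repr]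
      _ = _ := by simp only [map_sum, map_smul, smul_eq_mul, Module.Basis.coord_apply]
  simp_rw [hexp]
  rw [integral_finsetSum _ fun i _ ↦ (ψ.integrable_fderiv_apply _).const_mul _, Finset.sum_mul]
  refine (Finset.abs_sum_le_sum_abs _ _).trans (Finset.sum_le_sum fun i _ ↦ ?_)
  rw [integral_const_mul, abs_mul, mul_right_comm]
  exact mul_le_mul ((b.coord i).toContinuousLinearMap.le_opNorm h) (hC _ ψ hψ) (abs_nonneg _)
    (by positivity)

/-- A finite measure on `F` whose first order derivatives are finite measures does not charge
compact sets of Lebesgue measure zero. Indeed its mass on a small neighbourhood of the set is close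
to the average of the masses of the translates of that neighbourhood by the vectors of a ball, and
this average is controlled by the Lebesgue measure. -/
theorem measure_eq_zero_of_integral_fderiv_le (ν : Measure F) [ν.IsAddHaarMeasure]
    {μ : Measure F} [IsFiniteMeasure μ]
    (H : ∀ h : F, ∃ C, ∀ ψ : 𝓓((⊤ : Opens F), ℝ), (∀ y, |ψ y| ≤ 1) →
      |∫ y, fderiv ℝ ψ y h ∂μ| ≤ C) {K : Set F} (hK : IsCompact K) (hνK : ν K = 0) :
    μ K = 0 := by
  obtain ⟨C, hC0, hC⟩ := exists_forall_integral_fderiv_le H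
  have main : ∀ (r : ℝ) (ψ : 𝓓((⊤ : Opens F), ℝ)), 0 < r → (∀ y, ψ y ∈ Icc (0 : ℝ) 1) →
      ν.real (Metric.ball 0 r) * ∫ y, ψ y ∂μ ≤
        ν.real (Metric.ball 0 r) * (C * r) + μ.real univ * ∫ y, ψ y ∂ν := by
    intro r ψ hr hψ
    set B : Set F := Metric.ball 0 r
    have hψ1 : ∀ y, |ψ y| ≤ 1 := fun y ↦ abs_le.2 ⟨by linarith [(hψ y).1], (hψ y).2⟩
    have hBfin : ν B < ⊤ := measure_ball_lt_top
    have : IsFiniteMeasure (ν.restrict B) := ⟨by simpa using hBfin⟩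
    have hprod : Integrable (Function.uncurry fun h y ↦ ψ (y + h)) ((ν.restrict B).prod μ) :=
      Integrable.of_bound (ψ.continuous.comp
        (continuous_snd.add continuous_fst)).aestronglyMeasurable 1 (ae_of_all _ fun p ↦ hψ1 _)
    have hprod1 : Integrable (fun h ↦ ∫ y, ψ (y + h) ∂μ) (ν.restrict B) := hprod.integral_prod_left
    calc ν.real B * ∫ y, ψ y ∂μ = ∫ _ in B, (∫ y, ψ y ∂μ) ∂ν := by
          rw [setIntegral_const, smul_eq_mul]
      _ ≤ ∫ h in B, (C * r + ∫ y, ψ (y + h) ∂μ) ∂ν := by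
          refine setIntegral_mono_on (integrable_const _)
            ((integrable_const _).add hprod1) measurableSet_ball fun h hh ↦ ?_
          have h1 := abs_integral_translate_sub_le hC ψ hψ1 h
          have h2 : C * ‖h‖ ≤ C * r := mul_le_mul_of_nonneg_left (mem_ball_zero_iff.1 hh).le hC0
          linarith [neg_abs_le (∫ y, ψ (y + h) ∂μ - ∫ y, ψ y ∂μ)]
      _ = ν.real B * (C * r) + ∫ h in B, ∫ y, ψ (y + h) ∂μ ∂ν := by
          rw [integral_add (integrable_const _) hprod1, setIntegral_const,
            smul_eq_mul]
      _ = ν.real B * (C * r) + ∫ y, ∫ h in B, ψ (y + h) ∂ν ∂μ := by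
          rw [integral_integral_swap hprod]
      _ ≤ ν.real B * (C * r) + ∫ _, (∫ y, ψ y ∂ν) ∂μ := by
          refine add_le_add_right (integral_mono hprod.integral_prod_right (integrable_const _)
            fun y ↦ ?_) _
          have hy : Integrable (fun h ↦ ψ (y + h)) ν :=
            (ψ.integrable_of_isLocallyFiniteMeasure (μ := ν)).comp_add_left y
          calc ∫ h in B, ψ (y + h) ∂ν ≤ ∫ h, ψ (y + h) ∂ν :=
                setIntegral_le_integral hy (ae_of_all _ fun h ↦ (hψ _).1)
            _ = ∫ h, ψ h ∂ν := integral_add_left_eq_self (μ := ν) (⇑ψ) y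
      _ = _ := by rw [integral_const, smul_eq_mul]
  have key : ∀ ε : ℝ, 0 < ε → μ.real K ≤ ε := by
    intro ε hε
    -- the error `C r` of the translations is at most `ε / 2`; then `δ` makes the averaged term at
    -- most `ε / 2` as well, the `+ 1` only avoiding division by zero
    set r : ℝ := ε / (2 * (C + 1)) with hr
    have hr0 : 0 < r := by positivity
    have hCr : C * r ≤ ε / 2 := by
      rw [hr, mul_div_assoc', div_le_div_iff₀ (by positivity) (by positivity)]
      nlinarith
    have hB0 : 0 < ν.real (Metric.ball (0 : F) r) :=
      ENNReal.toReal_pos (Metric.measure_ball_pos ν 0 hr0).ne' measure_ball_lt_top.ne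
    set δ : ℝ := ε * ν.real (Metric.ball (0 : F) r) / (2 * (μ.real univ + 1)) with hδ
    have hM : 0 ≤ μ.real univ := measureReal_nonneg
    have hδ0 : 0 < δ := by positivity
    obtain ⟨V, hKV, hV, hVlt⟩ := K.exists_isOpen_lt_of_lt (μ := ν) (ENNReal.ofReal δ)
      (by simpa [hνK] using hδ0)
    obtain ⟨ψ, h1, hψV, h01⟩ := exists_testFunction_eq_one hK hV hKV
    have hψν : ∫ y, ψ y ∂ν ≤ δ := by
      calc ∫ y, ψ y ∂ν ≤ ∫ y, V.indicator 1 y ∂ν := by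
            refine integral_mono ψ.integrable_of_isLocallyFiniteMeasure ?_ fun x ↦ ?_
            · exact (integrableOn_const (hVlt.trans ENNReal.ofReal_lt_top).ne).integrable_indicator
                hV.measurableSet
            · by_cases hx : x ∈ V
              · simp [hx, (h01 x).2]
              · simp [hx, image_eq_zero_of_notMem_tsupport fun h ↦ hx (hψV h)]
        _ = ν.real V := integral_indicator_one hV.measurableSet
        _ ≤ δ := ENNReal.toReal_le_of_le_ofReal hδ0.le hVlt.le
    have hKψ : μ.real K ≤ ∫ y, ψ y ∂μ := by
      rw [← integral_indicator_one hK.measurableSet]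
      refine integral_mono ((integrable_const 1).indicator hK.measurableSet)
        ψ.integrable_of_isLocallyFiniteMeasure fun x ↦ ?_
      by_cases hx : x ∈ K
      · simp [hx, h1.self_of_nhdsSet x hx]
      · simp [hx, (h01 x).1]
    have hδ' : μ.real univ * ∫ y, ψ y ∂ν ≤ ν.real (Metric.ball (0 : F) r) * (ε / 2) := by
      refine (mul_le_mul_of_nonneg_left hψν hM).trans ?_
      rw [hδ, mul_div_assoc', div_le_iff₀ (by positivity)]
      nlinarith [mul_pos hε hB0]
    refine hKψ.trans (le_of_mul_le_mul_left ?_ hB0)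
    calc _ ≤ _ := main r ψ hr0 h01
      _ ≤ ν.real (Metric.ball (0 : F) r) * (ε / 2) + ν.real (Metric.ball (0 : F) r) * (ε / 2) :=
          add_le_add (mul_le_mul_of_nonneg_left hCr hB0.le) hδ'
      _ = _ := by ring
  have h0 : μ.real K = 0 := le_antisymm (le_of_forall_pos_le_add fun ε hε ↦ by simpa using key ε hε)
    measureReal_nonneg
  exact (measureReal_eq_zero_iff (measure_ne_top μ K)).1 h0

end BoundedDerivatives

/-! ### Alternating forms and exterior products -/

noncomputable section Covectors

open ContinuousAlternatingMap (alternatizeUncurryFin alternatizeUncurryFin_apply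
  curryLeft_apply_apply)

/-- The determinant as a continuous alternating form on `ℝᵏ`. -/
def detForm (k : ℕ) : (Fin k → ℝ) [⋀^Fin k]→L[ℝ] ℝ :=
  { (Matrix.detRowAlternating : (Fin k → ℝ) [⋀^Fin k]→ₗ[ℝ] ℝ) with
    cont := continuous_id.matrix_det }

section Contraction

variable {E : Type*} [NormedAddCommGroup E] [NormedSpace ℝ E] {k : ℕ}

/-- The exterior product `ℓ ↦ ℓ ∧ c` of a linear form with a vector valued alternating form. -/
def covectorWedge {G : Type*} [NormedAddCommGroup G] [NormedSpace ℝ G] (c : E [⋀^Fin k]→L[ℝ] G) :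
    (E →L[ℝ] ℝ) →ₗ[ℝ] E [⋀^Fin (k + 1)]→L[ℝ] G where
  toFun ℓ := alternatizeUncurryFin (ℓ.smulRight c)
  map_add' ℓ ℓ' := by
    rw [← ContinuousAlternatingMap.alternatizeUncurryFin_add]
    congr 1
    ext v
    simp [add_smul]
  map_smul' r ℓ := by
    rw [RingHom.id_apply, ← ContinuousAlternatingMap.alternatizeUncurryFin_smul]
    congr 1
    ext v
    simp [mul_smul]

theorem covectorWedge_apply {G : Type*} [NormedAddCommGroup G] [NormedSpace ℝ G]
    (c : E [⋀^Fin k]→L[ℝ] G) (ℓ : E →L[ℝ] ℝ) (v : Fin (k + 1) → E) :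
    covectorWedge c ℓ v = ∑ i : Fin (k + 1), (-1 : ℤ) ^ (i : ℕ) • (ℓ (v i) • c (i.removeNth v)) :=
  alternatizeUncurryFin_apply _ v

theorem HasFDerivAt.extDeriv_smul_const {G : Type*} [NormedAddCommGroup G] [NormedSpace ℝ G]
    {f : E → ℝ} {f' : E →L[ℝ] ℝ} {x : E} (hf : HasFDerivAt f f' x) (c : E [⋀^Fin k]→L[ℝ] G) :
    extDeriv (fun x ↦ f x • c) x = covectorWedge c f' := by
  rw [extDeriv, (hf.smul_const c).fderiv]
  rfl

/-- `ℓ ∧ (ι_h α) = ℓ(h) α` for a form `α` of top degree: contract `ℓ ∧ α = 0` with `h`. -/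
theorem sum_smul_curryLeft_removeNth_eq {F : Type*} [NormedAddCommGroup F] [NormedSpace ℝ F]
    [FiniteDimensional ℝ F] (hF : Module.finrank ℝ F = k + 1) (α : F [⋀^Fin (k + 1)]→L[ℝ] ℝ)
    (ℓ : F →L[ℝ] ℝ) (h : F) (v : Fin (k + 1) → F) :
    ∑ i : Fin (k + 1), (-1 : ℤ) ^ (i : ℕ) • (ℓ (v i) * α.curryLeft h (i.removeNth v)) =
      ℓ h * α v := by
  have h0 : covectorWedge α ℓ (Fin.cons h v) = 0 := by
    refine AlternatingMap.map_linearDependent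
      (covectorWedge α ℓ).toAlternatingMap _ fun hli ↦ ?_
    have := hli.fintype_card_le_finrank
    simp [hF] at this
  rw [covectorWedge_apply, Fin.sum_univ_succ] at h0
  simp only [Fin.val_zero, pow_zero, one_smul, Fin.cons_zero, Fin.removeNth_zero, Fin.tail_cons,
    smul_eq_mul, Fin.cons_succ, Fin.val_succ,
    pow_succ, mul_neg, mul_one, neg_smul, Finset.sum_neg_distrib] at h0
  rw [← sub_eq_add_neg, sub_eq_zero] at h0
  rw [h0]
  refine Finset.sum_congr rfl fun i _ ↦ ?_
  congr 2
  rw [curryLeft_apply_apply]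
  congr 1
  funext j
  refine Fin.cases ?_ (fun j ↦ ?_) j <;> simp [Fin.removeNth]

/-- The pullback to `E` of the Euclidean volume form by a linear map `π : E → ℝᵏ`. -/
def pullbackDet (π : E →L[ℝ] (Fin k → ℝ)) : E [⋀^Fin k]→L[ℝ] ℝ :=
  (detForm k).compContinuousLinearMap π

/-- The pullback to `E` of the contraction with `h` of the Euclidean volume form. -/
def pullbackContractedDet (π : E →L[ℝ] (Fin (k + 1) → ℝ)) (h : Fin (k + 1) → ℝ) :
    E [⋀^Fin k]→L[ℝ] ℝ :=
  ((detForm (k + 1)).curryLeft h).compContinuousLinearMap π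

theorem covectorWedge_pullbackContractedDet (π : E →L[ℝ] (Fin (k + 1) → ℝ))
    (h : Fin (k + 1) → ℝ) (ℓ : (Fin (k + 1) → ℝ) →L[ℝ] ℝ) :
    covectorWedge (pullbackContractedDet π h) (ℓ.comp π) =
      ℓ h • pullbackDet π := by
  ext v
  rw [covectorWedge_apply]
  exact sum_smul_curryLeft_removeNth_eq (by simp) (detForm (k + 1)) ℓ h (π ∘ v)

end Contraction

theorem covectorWedge_wedgeJ (n a b : ℕ) (ℓ : SuperBase n →L[ℝ] ℝ)
    (γ : PlainCovector n a) (β : PlainCovector n b) :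
    covectorWedge (SuperForm.wedgeJ n a b γ β) ℓ =
      SuperForm.wedgeJ n (a + 1) b (covectorWedge γ ℓ) β := by
  ext v w
  simp [covectorWedge_apply, SuperForm.wedgeJ_apply, Finset.sum_mul, mul_assoc]

/-- The projection of `ℝⁿ` to `ℝᵏ` given by `k` coordinates. -/
def coordProj {n k : ℕ} (I : Fin k → Fin n) : SuperBase n →L[ℝ] (Fin k → ℝ) :=
  ContinuousLinearMap.pi fun a ↦ EuclideanSpace.proj (I a)

/-- `k! β = ∑_I β(e_I) dx_I`, the sum being over all `k`-tuples of indices. -/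
theorem factorial_smul_eq_sum {n k : ℕ} (β : PlainCovector n k) :
    (k.factorial : ℝ) • β = ∑ I : Fin k → Fin n,
      β (fun a ↦ EuclideanSpace.basisFun (Fin n) ℝ (I a)) • pullbackDet (coordProj I) := by
  ext v
  -- for each permutation, multilinear expansion of `β` at the permuted tuple
  have hperm : ∀ σ : Equiv.Perm (Fin k), ∑ I : Fin k → Fin n, (∏ a, v (σ a) (I a)) *
      β (fun a ↦ EuclideanSpace.basisFun (Fin n) ℝ (I a)) = (Equiv.Perm.sign σ : ℤ) • β v := by
    intro σ
    have h1 : β (v ∘ σ) = (Equiv.Perm.sign σ : ℤ) • β v := by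
      rw [← Units.smul_def]
      exact β.toAlternatingMap.map_perm v σ
    rw [← h1]
    have h2 : v ∘ σ = fun a ↦ ∑ i, v (σ a) i • EuclideanSpace.basisFun (Fin n) ℝ i := by
      ext1 a
      exact ((EuclideanSpace.basisFun (Fin n) ℝ).sum_repr (v (σ a))).symm
    rw [h2]
    change _ = β.toMultilinearMap _
    rw [MultilinearMap.map_sum]
    refine Finset.sum_congr rfl fun I _ ↦ ?_
    rw [MultilinearMap.map_smul_univ]
    rfl
  simp only [ContinuousAlternatingMap.smul_apply, ContinuousAlternatingMap.sum_apply, smul_eq_mul]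
  have hdet : ∀ I : Fin k → Fin n, pullbackDet (coordProj I) v =
      ∑ σ : Equiv.Perm (Fin k), (Equiv.Perm.sign σ : ℤ) • ∏ a, v (σ a) (I a) := by
    intro I
    change Matrix.det (Matrix.of fun a b ↦ v a (I b)) = _
    rw [Matrix.det_apply]
    rfl
  simp_rw [hdet, Finset.mul_sum]
  rw [Finset.sum_comm]
  have : ∀ σ : Equiv.Perm (Fin k), ∑ I : Fin k → Fin n,
      β (fun a ↦ EuclideanSpace.basisFun (Fin n) ℝ (I a)) *
        ((Equiv.Perm.sign σ : ℤ) • ∏ a, v (σ a) (I a)) = β v := by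
    intro σ
    simp_rw [mul_smul_comm, ← Finset.smul_sum, mul_comm (β _), hperm, smul_smul]
    simp [← Units.val_mul]
  rw [Finset.sum_congr rfl fun σ _ ↦ this σ]
  simp [Fintype.card_perm]

theorem span_pullbackDet_coordProj (n k : ℕ) :
    Submodule.span ℝ (Set.range fun I : Fin k → Fin n ↦ pullbackDet (coordProj I)) = ⊤ := by
  refine Submodule.eq_top_iff'.2 fun β ↦ ?_
  have h : β = (k.factorial : ℝ)⁻¹ • ((k.factorial : ℝ) • β) := by
    rw [inv_smul_smul₀ (by positivity)]
  rw [h, factorial_smul_eq_sum]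
  exact Submodule.smul_mem _ _ (Submodule.sum_mem _ fun I _ ↦
    Submodule.smul_mem _ _ (Submodule.subset_span ⟨I, rfl⟩))

instance finite_plainCovector (n k : ℕ) : Module.Finite ℝ (PlainCovector n k) :=
  Module.Finite.of_fg_top
    (span_pullbackDet_coordProj n k ▸ Submodule.fg_span (Set.finite_range _))

/-- Super covectors are sums of products `β ∧ J(γ)`; with `γ` ranging over a basis. -/
theorem superCovector_eq_sum_wedgeJ {n a b : ℕ} {ι : Type*} [Fintype ι]
    (e : Module.Basis ι ℝ (PlainCovector n b)) (c : SuperCovector n a b) :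
    c = ∑ i, SuperForm.wedgeJ n a b
      ((e.coord i).toContinuousLinearMap.compContinuousAlternatingMap c) (e i) := by
  ext v w
  rw [ContinuousAlternatingMap.sum_apply, ContinuousAlternatingMap.sum_apply]
  simp only [SuperForm.wedgeJ_apply]
  conv_lhs => rw [← e.sum_repr (c v)]
  rw [ContinuousAlternatingMap.sum_apply]
  rfl

end Covectors

/-! ### Coefficients of currents -/

noncomputable section Coefficients

open Set Filter Topology SuperForm

theorem TestFunction.exists_eq_sum_smul {E G : Type*} [NormedAddCommGroup E] [NormedSpace ℝ E]
    [NormedAddCommGroup G] [NormedSpace ℝ G] [FiniteDimensional ℝ G] (α : 𝓓((⊤ : Opens E), G)) :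
    ∃ (k : ℕ) (c : Fin k → G) (φ : Fin k → 𝓓((⊤ : Opens E), ℝ)),
      ∀ x, α x = ∑ i, φ i x • c i := by
  let e := Module.finBasis ℝ G
  exact ⟨_, e, fun i ↦ ⟨fun x ↦ (e.coord i).toContinuousLinearMap (α x),
    (e.coord i).toContinuousLinearMap.contDiff.comp α.contDiff,
    α.hasCompactSupport.comp_left (map_zero (e.coord i).toContinuousLinearMap),
    fun _ _ ↦ trivial⟩, fun x ↦ (e.sum_repr (α x)).symm⟩

namespace SuperForm

variable {n a b m : ℕ}

theorem wedgeJ_add_left (β β' : PlainCovector n a) (γ : PlainCovector n b) :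
    wedgeJ n a b (β + β') γ = wedgeJ n a b β γ + wedgeJ n a b β' γ := by
  ext v w
  simp [wedgeJ_apply, add_mul]

theorem wedgeJ_smul_left (r : ℝ) (β : PlainCovector n a) (γ : PlainCovector n b) :
    wedgeJ n a b (r • β) γ = r • wedgeJ n a b β γ := by
  ext v w
  simp [wedgeJ_apply, mul_assoc]

instance finite_superCovector : Module.Finite ℝ (SuperCovector n a b) := by
  let e := Module.finBasis ℝ (PlainCovector n b)
  let f : (Fin (Module.finrank ℝ (PlainCovector n b)) → PlainCovector n a) →ₗ[ℝ]
      SuperCovector n a b :=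
    { toFun := fun γ ↦ ∑ i, wedgeJ n a b (γ i) (e i)
      map_add' := fun γ γ' ↦ by simp [wedgeJ_add_left, Finset.sum_add_distrib]
      map_smul' := fun r γ ↦ by simp [wedgeJ_smul_left, Finset.smul_sum] }
  exact Module.Finite.of_surjective f fun c ↦ ⟨_, (superCovector_eq_sum_wedgeJ e c).symm⟩

/-- The test form `ψ β` of bidegree `(m,0)`, for a scalar test function `ψ` and a covector `β`. -/
def smulPlain (β : PlainCovector n m) (ψ : 𝓓((⊤ : Opens (SuperBase n)), ℝ)) :
    𝓓((⊤ : Opens (SuperBase n)), PlainCovector n m) where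
  toFun x := ψ x • β
  contDiff' := contDiff_smul_const ψ.contDiff β
  hasCompactSupport' := ψ.hasCompactSupport.smul_right
  tsupport_subset' := fun _ _ ↦ trivial

end SuperForm

namespace SuperCurrent

variable {n a b m : ℕ}

/-- The coefficient `φ ↦ ⟨T, φ c⟩` of a functional on test forms, for a constant super
covector `c`. -/
def coefficient (T : SuperTestForm n a b →L[ℝ] ℝ) (c : SuperCovector n a b) :
    𝓓((⊤ : Opens (SuperBase n)), ℝ) →ₗ[ℝ] ℝ where
  toFun φ := T (smulConst n a b c φ)
  map_add' φ ψ := by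
    rw [← map_add]
    congr 1
    ext x : 1
    exact add_smul (φ x) (ψ x) c
  map_smul' r φ := by
    rw [RingHom.id_apply, ← map_smul]
    congr 1
    ext x : 1
    exact mul_smul r (φ x) c

theorem coefficient_apply (T : SuperTestForm n a b →L[ℝ] ℝ) (c : SuperCovector n a b)
    (φ : 𝓓((⊤ : Opens (SuperBase n)), ℝ)) : coefficient T c φ = T (smulConst n a b c φ) :=
  rfl

theorem coefficient_add (T : SuperTestForm n a b →L[ℝ] ℝ) (c c' : SuperCovector n a b) :
    coefficient T (c + c') = coefficient T c + coefficient T c' := by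
  refine LinearMap.ext fun φ ↦ ?_
  rw [LinearMap.add_apply, coefficient_apply, coefficient_apply, coefficient_apply, ← map_add]
  congr 1
  ext x : 1
  exact smul_add (φ x) c c'

theorem coefficient_smul (T : SuperTestForm n a b →L[ℝ] ℝ) (r : ℝ) (c : SuperCovector n a b) :
    coefficient T (r • c) = r • coefficient T c := by
  refine LinearMap.ext fun φ ↦ ?_
  rw [LinearMap.smul_apply, coefficient_apply, coefficient_apply, ← map_smul]
  congr 1
  ext x : 1
  exact smul_comm (φ x) r c

/-- The coefficients of `T` as a linear function of the covector. -/
def coefficientHom (T : SuperTestForm n a b →L[ℝ] ℝ) :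
    SuperCovector n a b →ₗ[ℝ] 𝓓((⊤ : Opens (SuperBase n)), ℝ) →ₗ[ℝ] ℝ where
  toFun := coefficient T
  map_add' := coefficient_add T
  map_smul' := coefficient_smul T

theorem coefficient_sum (T : SuperTestForm n a b →L[ℝ] ℝ) {ι : Type*} (s : Finset ι)
    (c : ι → SuperCovector n a b) :
    coefficient T (∑ i ∈ s, c i) = ∑ i ∈ s, coefficient T (c i) :=
  map_sum (coefficientHom T) c s

theorem coefficient_smul_left (T : SuperTestForm n a b →L[ℝ] ℝ) (r : ℝ)
    (c : SuperCovector n a b) : coefficient (r • T) c = r • coefficient T c :=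
  rfl

/-- A functional on test forms is zero if all its coefficients are. -/
theorem eq_zero_of_coefficient_eq_zero {T : SuperTestForm n a b →L[ℝ] ℝ}
    (h : ∀ c, coefficient T c = 0) : T = 0 := by
  ext α
  obtain ⟨k, c, φ, hφ⟩ := TestFunction.exists_eq_sum_smul α
  have hα : α = ∑ i, smulConst n a b (c i) (φ i) := by
    ext x : 1
    rw [_root_.sum_apply]
    exact hφ x
  rw [hα, map_sum]
  exact Finset.sum_eq_zero fun i _ ↦ LinearMap.congr_fun (h (c i)) (φ i)

section Positive

variable {T : SuperTestForm n m m →L[ℝ] ℝ}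

theorem coefficient_wedgeJ_self_nonneg
    (hpos : ∀ β : 𝓓((⊤ : Opens (SuperBase n)), PlainCovector n m), 0 ≤ T (wedgeJSelf n m β))
    (β : PlainCovector n m) {φ : 𝓓((⊤ : Opens (SuperBase n)), ℝ)} (hφ : ∀ x, 0 ≤ φ x) :
    0 ≤ coefficient T (wedgeJ n m m β β) φ := by
  obtain ⟨χ, h1, -, h01⟩ := exists_testFunction_eq_one φ.hasCompactSupport.isCompact isOpen_univ
    (subset_univ _)
  set A := coefficient T (wedgeJ n m m β β) φ with hA
  set B := coefficient T (wedgeJ n m m β β) (TestFunction.smoothMul χ χ.contDiff χ)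
  have key : ∀ ε : ℝ, 0 < ε → 0 ≤ A + ε * B := by
    intro ε hε
    obtain ⟨ψ, hψ⟩ := exists_testFunction_sq_eq φ χ hφ (fun x ↦ (h01 x).1)
      (fun x hx ↦ h1.self_of_nhdsSet x hx) hε
    have h := hpos (smulPlain β ψ)
    have heq : wedgeJSelf n m (smulPlain β ψ) = smulConst n m m (wedgeJ n m m β β)
        (φ + ε • TestFunction.smoothMul χ χ.contDiff χ) := by
      ext x v w
      change (ψ x * β v) * (ψ x * β w) = (φ x + ε * (χ x * χ x)) * wedgeJ n m m β β v w
      rw [wedgeJ_apply, ← sq (χ x), ← hψ x]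
      ring
    rw [heq, ← coefficient_apply, map_add, map_smul] at h
    exact h
  by_contra! hneg
  have h := key (-A / (2 * (|B| + 1))) (div_pos (by linarith) (by positivity))
  have h2 : -A / (2 * (|B| + 1)) * B ≤ -A / 2 := by
    rw [div_mul_eq_mul_div, div_le_div_iff₀ (by positivity) (by positivity)]
    nlinarith [le_abs_self B]
  linarith

theorem exists_measure_coefficient_wedgeJ_self
    (hpos : ∀ β : 𝓓((⊤ : Opens (SuperBase n)), PlainCovector n m), 0 ≤ T (wedgeJSelf n m β))
    (β : PlainCovector n m) :
    ∃ μ : Measure (SuperBase n), IsLocallyFiniteMeasure μ ∧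
      ∀ φ, coefficient T (wedgeJ n m m β β) φ = ∫ x, φ x ∂μ :=
  exists_measure_of_nonneg _ fun _ hφ ↦ coefficient_wedgeJ_self_nonneg hpos β hφ

/-- By polarization, all coefficients are signed measures vanishing on `K` as soon as the diagonal
ones `β ∧ J(β)` vanish on `K`. -/
theorem isSignedMeasureNullOn_coefficient {K : Set (SuperBase n)}
    (hsymm : ∀ β γ, coefficient T (wedgeJ n m m β γ) = coefficient T (wedgeJ n m m γ β))
    (hdiag : ∀ β, ∃ μ : Measure (SuperBase n), IsLocallyFiniteMeasure μ ∧
      (∀ φ, coefficient T (wedgeJ n m m β β) φ = ∫ x, φ x ∂μ) ∧ μ K = 0)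
    (c : SuperCovector n m m) : IsSignedMeasureNullOn (coefficient T c) K := by
  have hdiag' : ∀ β, IsSignedMeasureNullOn (coefficient T (wedgeJ n m m β β)) K := by
    intro β
    obtain ⟨μ, hμ, hT, hK⟩ := hdiag β
    exact ⟨μ, 0, hμ, inferInstance, fun φ ↦ by simp [hT], hK, by simp⟩
  have hpol : ∀ β γ, IsSignedMeasureNullOn (coefficient T (wedgeJ n m m β γ)) K := by
    intro β γ
    have h : wedgeJ n m m (β + γ) (β + γ) + (-1 : ℝ) • wedgeJ n m m (β - γ) (β - γ) =
        (2 : ℝ) • wedgeJ n m m β γ + (2 : ℝ) • wedgeJ n m m γ β := by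
      ext v w
      simp [wedgeJ_apply]
      ring
    have h' := congrArg (coefficient T) h
    simp only [coefficient_add, coefficient_smul, hsymm γ β] at h'
    have h2 : coefficient T (wedgeJ n m m β γ) = (1 / 4 : ℝ) •
        (coefficient T (wedgeJ n m m (β + γ) (β + γ)) +
          (-1 : ℝ) • coefficient T (wedgeJ n m m (β - γ) (β - γ))) := by
      rw [h']
      refine LinearMap.ext fun φ ↦ ?_
      simp only [LinearMap.smul_apply, LinearMap.add_apply, smul_eq_mul]
      ring
    rw [h2]
    exact ((hdiag' _).add ((hdiag' _).smul _)).smul _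
  rw [superCovector_eq_sum_wedgeJ (Module.finBasis ℝ (PlainCovector n m)) c, coefficient_sum]
  exact IsSignedMeasureNullOn.sum _ fun i _ ↦ hpol _ _

/-- The covectors `β` whose diagonal coefficient `β ∧ J(β)` vanishes on the compact set `K` form a
subspace, by the parallelogram law; so it is enough to look at a spanning set of covectors. -/
theorem exists_measure_null_of_span_eq_top {K : Set (SuperBase n)} (hK : IsCompact K)
    (hpos : ∀ β : 𝓓((⊤ : Opens (SuperBase n)), PlainCovector n m), 0 ≤ T (wedgeJSelf n m β))
    {S : Set (PlainCovector n m)} (hS : Submodule.span ℝ S = ⊤)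
    (h : ∀ β ∈ S, ∀ μ : Measure (SuperBase n), IsLocallyFiniteMeasure μ →
      (∀ φ, coefficient T (wedgeJ n m m β β) φ = ∫ x, φ x ∂μ) → μ K = 0)
    (β : PlainCovector n m) : ∃ μ : Measure (SuperBase n), IsLocallyFiniteMeasure μ ∧
      (∀ φ, coefficient T (wedgeJ n m m β β) φ = ∫ x, φ x ∂μ) ∧ μ K = 0 := by
  choose μ hμ hT using exists_measure_coefficient_wedgeJ_self hpos
  refine ⟨μ β, hμ β, hT β, ?_⟩
  have hβ : β ∈ Submodule.span ℝ S := hS ▸ Submodule.mem_top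
  induction hβ using Submodule.span_induction with
  | mem β hβ => exact h β hβ (μ β) (hμ β) (hT β)
  | zero =>
    refine le_antisymm ((measure_le_of_integral_testFunction_le (ν := 0) (fun φ _ ↦ ?_)
      hK).trans_eq (by simp)) zero_le
    have h0 : wedgeJ n m m (0 : PlainCovector n m) 0 = (0 : ℝ) • wedgeJ n m m 0 0 := by
      ext v w
      simp [wedgeJ_apply]
    rw [← hT, h0, coefficient_smul]
    simp
  | add β γ _ _ hβ hγ =>
    have := isLocallyFiniteMeasure_add (μ β) (μ γ)
    refine le_antisymm ((measure_le_of_integral_testFunction_le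
      (ν := (2 : NNReal) • (μ β + μ γ)) (fun φ hφ ↦ ?_) hK).trans_eq (by simp [hβ, hγ])) zero_le
    rw [integral_smul_nnreal_measure, integral_add_measure φ.integrable_of_isLocallyFiniteMeasure
      φ.integrable_of_isLocallyFiniteMeasure, ← hT, ← hT, ← hT]
    have hpar : wedgeJ n m m (β + γ) (β + γ) + wedgeJ n m m (β - γ) (β - γ) =
        (2 : ℝ) • wedgeJ n m m β β + (2 : ℝ) • wedgeJ n m m γ γ := by
      ext v w
      simp [wedgeJ_apply]
      ring
    have hpar' := LinearMap.congr_fun (congrArg (coefficient T) hpar) φ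
    simp only [coefficient_add, coefficient_smul, LinearMap.add_apply, LinearMap.smul_apply,
      smul_eq_mul] at hpar'
    have hnn := coefficient_wedgeJ_self_nonneg hpos (β - γ) hφ
    simp only [NNReal.smul_def, smul_eq_mul, NNReal.coe_ofNat]
    linarith
  | smul r β _ hβ =>
    refine le_antisymm ((measure_le_of_integral_testFunction_le
      (ν := (r ^ 2).toNNReal • μ β) (fun φ hφ ↦ ?_) hK).trans_eq (by simp [hβ])) zero_le
    have hr : wedgeJ n m m (r • β) (r • β) = r ^ 2 • wedgeJ n m m β β := by
      ext v w
      simp [wedgeJ_apply]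
      ring
    rw [integral_smul_nnreal_measure, ← hT, ← hT, hr, coefficient_smul, NNReal.smul_def,
      Real.coe_toNNReal _ (sq_nonneg r)]
    exact le_rfl

end Positive

end SuperCurrent

end Coefficients

/-! ### Closed positive currents -/

noncomputable section Closed

open Set Filter Topology SuperForm

theorem contDiff_fderiv_comp_apply {E F : Type*} [NormedAddCommGroup E] [NormedSpace ℝ E]
    [NormedAddCommGroup F] [NormedSpace ℝ F] (ψ : 𝓓((⊤ : Opens F), ℝ)) (π : E →L[ℝ] F) (h : F) :
    ContDiff ℝ (⊤ : ℕ∞) fun x ↦ fderiv ℝ ψ (π x) h :=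
  ((ψ.contDiff.fderiv_right (m := (⊤ : ℕ∞)) (by simp)).comp π.contDiff).clm_apply contDiff_const

theorem tsupport_smulConst_subset (n a b : ℕ) (c : SuperCovector n a b)
    (φ : 𝓓((⊤ : Opens (SuperBase n)), ℝ)) : tsupport (smulConst n a b c φ) ⊆ tsupport φ :=
  closure_mono fun x hx hφ ↦ hx <| by
    ext v w
    simp [smulConst_apply, hφ]

namespace SuperCurrent

variable {n m : ℕ}

/-- The exterior derivative of `φ · (ψ ∘ π) · π^*(ι_h det) ∧ J(π^* det)` is
`φ · (∂_h ψ ∘ π) · π^* det ∧ J(π^* det)` plus terms in which only `φ` is differentiated. -/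
theorem d_smulConst_pullbackContractedDet (π : SuperBase n →L[ℝ] (Fin (m + 1) → ℝ))
    (h : Fin (m + 1) → ℝ) (β : PlainCovector n (m + 1))
    (ψ : 𝓓((⊤ : Opens (Fin (m + 1) → ℝ)), ℝ)) (φ : 𝓓((⊤ : Opens (SuperBase n)), ℝ)) :
    d n m (m + 1) (smulConst n m (m + 1) (wedgeJ n m (m + 1) (pullbackContractedDet π h) β)
        (TestFunction.smoothMul (ψ ∘ π) (ψ.contDiff.comp π.contDiff) φ)) =
      smulConst n (m + 1) (m + 1) (wedgeJ n (m + 1) (m + 1) (pullbackDet π) β)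
        (TestFunction.smoothMul (fun x ↦ fderiv ℝ ψ (π x) h) (contDiff_fderiv_comp_apply ψ π h) φ) +
      ∑ j, smulConst n (m + 1) (m + 1) (covectorWedge
          (wedgeJ n m (m + 1) (pullbackContractedDet π h) β) (EuclideanSpace.proj j))
        (TestFunction.smoothMul (ψ ∘ π) (ψ.contDiff.comp π.contDiff)
          (TestFunction.lineDerivCLM ℝ (EuclideanSpace.basisFun (Fin n) ℝ j) φ)) := by
  ext x : 1
  set c := wedgeJ n m (m + 1) (pullbackContractedDet π h) β with hc
  rw [d_apply]
  have hφ : HasFDerivAt φ (fderiv ℝ φ x) x :=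
    (φ.contDiff.differentiable (by simp) x).hasFDerivAt
  have hψ : HasFDerivAt (ψ ∘ π) ((fderiv ℝ ψ (π x)).comp π) x :=
    (ψ.contDiff.differentiable (by simp) (π x)).hasFDerivAt.comp x π.hasFDerivAt
  have hext : extDeriv (smulConst n m (m + 1) c
      (TestFunction.smoothMul (ψ ∘ π) (ψ.contDiff.comp π.contDiff) φ)) x =
      covectorWedge c (ψ (π x) • fderiv ℝ φ x + φ x • (fderiv ℝ ψ (π x)).comp π) :=
    (hψ.mul hφ).extDeriv_smul_const c
  have hd : ∀ j, (TestFunction.lineDerivCLM ℝ (EuclideanSpace.basisFun (Fin n) ℝ j) φ :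
      𝓓((⊤ : Opens (SuperBase n)), ℝ)) x = fderiv ℝ φ x (EuclideanSpace.basisFun (Fin n) ℝ j) := by
    intro j
    rw [TestFunction.lineDerivCLM_eq_fderivCLM, TestFunction.fderivCLM_apply]
    simp
  have hsum : fderiv ℝ φ x = ∑ j, fderiv ℝ φ x (EuclideanSpace.basisFun (Fin n) ℝ j) •
      (EuclideanSpace.proj j : SuperBase n →L[ℝ] ℝ) := by
    ext v
    calc fderiv ℝ φ x v = fderiv ℝ φ x (∑ j, v j • EuclideanSpace.basisFun (Fin n) ℝ j) :=
          congrArg _ ((EuclideanSpace.basisFun (Fin n) ℝ).sum_repr v).symm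
      _ = _ := by simp [map_sum, mul_comm]
  have hπ : covectorWedge c ((fderiv ℝ ψ (π x)).comp π) =
      fderiv ℝ ψ (π x) h • wedgeJ n (m + 1) (m + 1) (pullbackDet π) β := by
    rw [hc, covectorWedge_wedgeJ, covectorWedge_pullbackContractedDet, wedgeJ_smul_left]
  rw [hext, map_add, map_smul, map_smul]
  rw [hπ, hsum, map_sum, add_comm (ψ (π x) • _), FunLike.coe_add, Pi.add_apply, _root_.sum_apply]
  congr 1
  · rw [smulConst_apply, TestFunction.smoothMul_apply, smul_smul, mul_comm]
  · rw [Finset.smul_sum]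
    refine Finset.sum_congr rfl fun j _ ↦ ?_
    rw [smulConst_apply, TestFunction.smoothMul_apply, hd, map_smul, smul_smul]
    simp only [Function.comp_apply]

/-- The diagonal coefficient `μ` of `T` along `π^* det` does not charge compact sets that
are null for the Hausdorff measure of dimension `m + 1`: since `dT = 0` and the coefficients
of `T` are measures, the derivatives of the image under `π` of `φ μ` are measures, for any
cutoff `φ`. -/
theorem measure_eq_zero_of_hausdorffMeasure_eq_zero
    {T : SuperTestForm n (m + 1) (m + 1) →L[ℝ] ℝ}
    (hclosed : ∀ α : SuperTestForm n m (m + 1), T (d n m (m + 1) α) = 0)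
    (hmeas : ∀ c, IsSignedMeasureNullOn (coefficient T c) ∅)
    (π : SuperBase n →L[ℝ] (Fin (m + 1) → ℝ)) {μ : Measure (SuperBase n)}
    [IsLocallyFiniteMeasure μ]
    (hμ : ∀ φ, coefficient T (wedgeJ n (m + 1) (m + 1) (pullbackDet π) (pullbackDet π)) φ =
      ∫ x, φ x ∂μ)
    {K : Set (SuperBase n)} (hK : IsCompact K)
    (hH : Measure.hausdorffMeasure ((m + 1 : ℕ) : ℝ) K = 0) : μ K = 0 := by
  obtain ⟨φ, h1, -, h01⟩ := exists_testFunction_eq_one hK isOpen_univ (subset_univ _)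
  have hφm : Measurable fun x ↦ ENNReal.ofReal (φ x) :=
    (ENNReal.continuous_ofReal.comp φ.continuous).measurable
  have hfin : IsFiniteMeasure (μ.withDensity fun x ↦ ENNReal.ofReal (φ x)) :=
    isFiniteMeasure_withDensity_ofReal
      (φ.integrable_of_isLocallyFiniteMeasure (μ := μ)).hasFiniteIntegral
  -- the image of the finite measure `φ μ` under the projection
  set ν := (μ.withDensity fun x ↦ ENNReal.ofReal (φ x)).map π with hν
  have hπK : volume (π '' K) = 0 := by
    rw [← hausdorffMeasure_pi_real, Fintype.card_fin]
    refine le_antisymm ((π.lipschitz.hausdorffMeasure_image_le (Nat.cast_nonneg _) K).trans ?_)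
      zero_le
    rw [hH, mul_zero]
  have hνK : ν (π '' K) = 0 := by
    refine measure_eq_zero_of_integral_fderiv_le volume (fun h ↦ ?_) (hK.image π.continuous) hπK
    choose C hC using fun j : Fin n ↦ (hmeas (covectorWedge
      (wedgeJ n m (m + 1) (pullbackContractedDet π h) (pullbackDet π))
      (EuclideanSpace.proj j)))
      |>.exists_bound (TestFunction.lineDerivCLM ℝ (EuclideanSpace.basisFun (Fin n) ℝ j) φ)
    refine ⟨∑ j, C j, fun ψ hψ ↦ ?_⟩
    have hint : ∫ y, fderiv ℝ ψ y h ∂ν = coefficient T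
        (wedgeJ n (m + 1) (m + 1) (pullbackDet π) (pullbackDet π))
        (TestFunction.smoothMul (fun x ↦ fderiv ℝ ψ (π x) h)
          (contDiff_fderiv_comp_apply ψ π h) φ) := by
      rw [hμ, hν, integral_map π.continuous.aemeasurable
        ((ψ.contDiff.continuous_fderiv (by simp)).clm_apply continuous_const).aestronglyMeasurable,
        integral_withDensity_eq_integral_toReal_smul hφm (by simp)]
      refine integral_congr_ae (ae_of_all _ fun x ↦ ?_)
      simp only [TestFunction.smoothMul_apply, smul_eq_mul, ENNReal.toReal_ofReal (h01 x).1]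
      ring
    have hT := hclosed (smulConst n m (m + 1)
      (wedgeJ n m (m + 1) (pullbackContractedDet π h) (pullbackDet π))
      (TestFunction.smoothMul (ψ ∘ π) (ψ.contDiff.comp π.contDiff) φ))
    rw [d_smulConst_pullbackContractedDet, map_add, map_sum, ← coefficient_apply, ← hint,
      add_eq_zero_iff_eq_neg] at hT
    rw [hT, abs_neg]
    exact (Finset.abs_sum_le_sum_abs _ _).trans
      (Finset.sum_le_sum fun j _ ↦ hC j _ _ fun x ↦ hψ (π x))
  rw [hν, Measure.map_apply π.continuous.measurable (hK.image π.continuous).measurableSet] at hνK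
  have hK0 := measure_mono_null (subset_preimage_image π K) hνK
  rw [withDensity_apply _ hK.measurableSet] at hK0
  rw [← hK0, setLIntegral_congr_fun hK.measurableSet (g := fun _ ↦ 1) fun x hx ↦ ?_,
    setLIntegral_one]
  simp [h1.self_of_nhdsSet x hx]

theorem isSignedMeasureNullOn_coefficient_of_hausdorffMeasure_eq_zero
    {T : SuperTestForm n m m →L[ℝ] ℝ} (hclosed : IsDClosed T)
    (hsymm : ∀ β γ, coefficient T (wedgeJ n m m β γ) = coefficient T (wedgeJ n m m γ β))
    (hpos : ∀ β : 𝓓((⊤ : Opens (SuperBase n)), PlainCovector n m), 0 ≤ T (wedgeJSelf n m β))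
    {K : Set (SuperBase n)} (hK : IsCompact K)
    (hH : Measure.hausdorffMeasure (m : ℝ) K = 0) (c : SuperCovector n m m) :
    IsSignedMeasureNullOn (coefficient T c) K := by
  have hmeas : ∀ c, IsSignedMeasureNullOn (coefficient T c) ∅ :=
    isSignedMeasureNullOn_coefficient hsymm fun β ↦ by
      obtain ⟨μ, hμ, hT⟩ := exists_measure_coefficient_wedgeJ_self hpos β
      exact ⟨μ, hμ, hT, measure_empty⟩
  cases m with
  | zero =>
    -- zero-dimensional Hausdorff measure is at least `1` on nonempty sets
    have hKe : K = ∅ := by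
      by_contra hne
      have := Measure.one_le_hausdorffMeasure_zero_of_nonempty (nonempty_iff_ne_empty.2 hne)
      rw [Nat.cast_zero] at hH
      simp [hH] at this
    exact hKe ▸ hmeas c
  | succ m =>
    refine isSignedMeasureNullOn_coefficient hsymm
      (exists_measure_null_of_span_eq_top hK hpos (span_pullbackDet_coordProj n (m + 1)) ?_) c
    rintro _ ⟨I, rfl⟩ μ hμ hT
    exact measure_eq_zero_of_hausdorffMeasure_eq_zero hclosed hmeas (coordProj I) hT hK hH

end SuperCurrent

theorem SuperCurrent.IsSymmetric.coefficient_wedgeJ_comm {n p : ℕ} {T : SuperCurrent n p p}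
    (h : SuperCurrent.IsSymmetric T) (β γ : PlainCovector n (n - p)) :
    SuperCurrent.coefficient T (wedgeJ n (n - p) (n - p) β γ) =
      SuperCurrent.coefficient T (wedgeJ n (n - p) (n - p) γ β) := by
  refine LinearMap.ext fun φ ↦ h _ _ fun x v w ↦ ?_
  change φ x * wedgeJ n _ _ β γ v w = φ x * wedgeJ n _ _ γ β w v
  rw [wedgeJ_apply, wedgeJ_apply, mul_comm (β v)]

theorem SuperCurrent.IsDClosed.smul {n a b : ℕ} {T : SuperTestForm n a b →L[ℝ] ℝ}
    (h : SuperCurrent.IsDClosed T) (r : ℝ) : SuperCurrent.IsDClosed (r • T) := by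
  cases a with
  | zero => trivial
  | succ a => exact fun α ↦ by rw [_root_.smul_apply, h α, smul_zero]

theorem SuperCurrent.coefficient_eq_zero_of_disjoint_supp {n p q : ℕ} {T : SuperCurrent n p q}
    (c : SuperCovector n (n - p) (n - q)) {φ : 𝓓((⊤ : Opens (SuperBase n)), ℝ)}
    (h : Disjoint (tsupport φ) (SuperCurrent.supp T)) : SuperCurrent.coefficient T c φ = 0 := by
  obtain ⟨U, -, hU, h0⟩ := exists_isOpen_forall_eq_zero (SuperCurrent.coefficient T c)
    φ.hasCompactSupport.isCompact fun x hx ↦ by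
      obtain ⟨s, hs, hso, hxs⟩ := (Distribution.notMem_dsupport_iff x).1
        (Set.disjoint_left.1 h hx)
      exact ⟨s, hso, hxs, fun ψ hψ ↦ hs _ ((tsupport_smulConst_subset _ _ _ c ψ).trans hψ)⟩
  exact h0 φ hU

end Closed

theorem mainTheorem11 (n p : ℕ) (hp : p ≤ n) (T : SuperCurrent n p p)
    (hclosed : SuperCurrent.IsDClosed T) (hpos : SuperCurrent.IsPositive T) :
    (∀ K : Set (SuperBase n), IsCompact K →
      Measure.hausdorffMeasure ((n - p : ℕ) : ℝ) K = 0 → SuperCurrent.VanishesOn T K) ∧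
    (Measure.hausdorffMeasure ((n - p : ℕ) : ℝ) (SuperCurrent.supp T) = 0 → T = 0) := by
  set s : ℝ := (-1 : ℝ) ^ ((n - p) * (n - p - 1) / 2) with hs
  have hss : s * s = 1 := by
    rw [hs, ← mul_pow]
    norm_num
  have hnull : ∀ K : Set (SuperBase n), IsCompact K →
      Measure.hausdorffMeasure ((n - p : ℕ) : ℝ) K = 0 →
      ∀ c, IsSignedMeasureNullOn (SuperCurrent.coefficient T c) K := by
    intro K hK hH c
    -- the sign in the definition of positivity is moved into the current
    have h := (SuperCurrent.isSignedMeasureNullOn_coefficient_of_hausdorffMeasure_eq_zero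
      (T := s • T) (hclosed.smul s)
      (fun β γ ↦ by rw [SuperCurrent.coefficient_smul_left, SuperCurrent.coefficient_smul_left,
        hpos.1.coefficient_wedgeJ_comm])
      (fun β ↦ by
        have := hpos.2 β
        rwa [map_smul] at this) hK hH c).smul s
    rw [SuperCurrent.coefficient_smul_left] at h
    have he : s • s • SuperCurrent.coefficient T c = SuperCurrent.coefficient T c :=
      LinearMap.ext fun φ ↦ by
        rw [LinearMap.smul_apply, LinearMap.smul_apply, smul_smul, hss, one_smul]
    rwa [he] at h
  refine ⟨fun K hK hH c ↦ (hnull K hK hH c).exists_mutuallySingular, fun hH ↦ ?_⟩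
  refine SuperCurrent.eq_zero_of_coefficient_eq_zero fun c ↦ LinearMap.ext fun φ ↦ ?_
  -- only the compact part of the support of `T` that meets the support of `φ` matters
  have hK : IsCompact (tsupport φ ∩ SuperCurrent.supp T) :=
    φ.hasCompactSupport.isCompact.inter_right Distribution.isClosed_dsupport
  refine (hnull _ hK (measure_mono_null Set.inter_subset_right hH) c).apply_eq_zero hK φ
    fun ψ hψ ↦ SuperCurrent.coefficient_eq_zero_of_disjoint_supp c ?_
  exact Set.disjoint_left.2 fun x hx hxT ↦ (hψ hx).2 ⟨(hψ hx).1, hxT⟩
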